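/- **Theorem (Inverse energy inequality).** Let $\mathcal F_{\rm rad}=\bigoplus_{n\ge 0}\bigotimes_s^n L^2(\mathbb R^3\times\{1,2\})$ be the boson Fock space, with annihilation operators $a(f)$, creation operators $a(f)^*$ and second quantizations $d\Gamma(\cdot)$. Let $\alpha_1,\alpha_2,\alpha_3,\beta$ be Dirac matrices, i.e. Hermitian $4\times4$ matrices with $\alpha_j\alpha_l+\alpha_l\alpha_j=2\delta_{jl}$, $\alpha_j\beta+\beta\alpha_j=0$, $\beta^2=1$. Let $\mathbf e^{(1)},\mathbf e^{(2)}:\mathbb R^3\to\mathbb R^3$ be Borel measurable polarization vectors: $\mathbf e^{(\lambda)}(\mathbf k)\cdot\mathbf e^{(\mu)}(\mathbf k)=\delta_{\lambda\mu}$ and $\mathbf e^{(\lambda)}(\mathbf k)\cdot\mathbf k=0$ for all $\mathbf k$. Let $\rho:\mathbb R^3\to\mathbb C$ satisfy $\rho\in L^2(\mathbb R^3)$ and $|\mathbf k|^{-1}\rho\in L^2(\mathbb R^3)$, and let $M,q\in\mathbb R$, $m\ge 0$. Put $$g_j(\mathbf k,\lambda)=|\mathbf k|^{-1/2}\rho(\mathbf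 k)e^{(\lambda)}_j(\mathbf k),\qquad A_j=\tfrac1{\sqrt2}\,\overline{a(g_j)+a(g_j)^*},\qquad \omega_m(\mathbf k)=(1+m)|\mathbf k|+m,$$ and, for $\mathbf p\in\mathbb R^3$, define on $\mathbb C^4\otimes\mathcal F_{\rm rad}$ the Dirac polaron Hamiltonian $$H_m(\mathbf p)=\vec\alpha\cdot\mathbf p+M\beta+d\Gamma(\omega_m)-\vec\alpha\cdot d\Gamma(\mathbf k)-q\,\vec\alpha\cdot\mathbf A ,$$ with lowest energy $E_m(\mathbf p)=\inf\sigma\big(\overline{H_m(\mathbf p)}\big)$, where $\overline{\,\cdot\,}$ denotes the closure, $\sigma$ the spectrum, and the infimum (of real parts of spectral points) is taken in $[-\infty,\infty]$. Assume that $|\rho(\mathbf k)|=|\rho(-\mathbf k)|$ for almost every $\mathbf k\in\mathbb R^3$. Then $$E_m(\mathbf p)\le E_m(0)\qquad\text{for all }\mathbf p\in\mathbb R^3 .$$ -/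

import Mathlib

open MeasureTheory

noncomputable section

namespace DiracPolaron

/-- Momentum space `ℝ³` with its Euclidean norm. -/
abbrev Momentum : Type := EuclideanSpace ℝ (Fin 3)

/-- The one-photon configuration space `ℝ³ × {1, 2}` (momentum and polarization index). -/
abbrev Mode : Type := Momentum × Fin 2

/-- Lebesgue measure on `ℝ³` times counting measure on the polarization index. -/
abbrev modeMeasure : Measure Mode := (volume : Measure Momentum).prod Measure.count

/-- The product measure on `n`-photon configurations. -/
abbrev confMeasure (n : ℕ) : Measure (Fin n → Mode) := Measure.pi fun _ => modeMeasure

/-! ### The boson Fock space over `L²(ℝ³ × {1, 2})` -/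

theorem measurePreserving_perm {n : ℕ} (σ : Equiv.Perm (Fin n)) :
    MeasurePreserving (fun x : Fin n → Mode => x ∘ σ) (confMeasure n) (confMeasure n) := by
  have h := measurePreserving_piCongrLeft (α := fun _ : Fin n => Mode)
    (fun _ => modeMeasure) σ.symm
  convert h using 1
  funext x
  funext i
  have := Equiv.piCongrLeft_apply_apply (fun _ : Fin n => Mode) σ.symm x (σ i)
  simpa [MeasurableEquiv.coe_piCongrLeft] using this.symm

/-- The `n`-photon space `⊗ₛⁿ L²(ℝ³ × {1, 2})`, realized as the space of those square integrable
functions of `n` photon variables that are invariant under all permutations of the variables. -/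
def NPhoton (n : ℕ) : Submodule ℂ (Lp ℂ 2 (confMeasure n)) :=
  ⨅ σ : Equiv.Perm (Fin n), LinearMap.eqLocus
    (Lp.compMeasurePreservingₗ ℂ (fun x : Fin n → Mode => x ∘ σ) (measurePreserving_perm σ))
    LinearMap.id

instance (n : ℕ) : CompleteSpace (NPhoton n) := by
  refine @IsClosed.completeSpace_coe _ _ _ (NPhoton n : Set (Lp ℂ 2 (confMeasure n))) ?_
  have h : (NPhoton n : Set (Lp ℂ 2 (confMeasure n))) = ⋂ σ : Equiv.Perm (Fin n),
      {f | Lp.compMeasurePreserving (fun x : Fin n → Mode => x ∘ σ)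
        (measurePreserving_perm σ) f = f} := by
    ext f
    simp only [NPhoton, Submodule.coe_iInf, Set.mem_iInter]
    rfl
  rw [h]
  exact isClosed_iInter fun σ => isClosed_eq
    (Lp.isometry_compMeasurePreserving (measurePreserving_perm σ)).continuous continuous_id

/-- The boson Fock space: the Hilbert space direct sum of the `n`-photon spaces, `n ≥ 0`. -/
abbrev Fock : Type := lp (fun n : ℕ => NPhoton n) 2

/-- The `n`-photon component of a Fock space vector, as a function of `n` photon variables
(defined up to almost everywhere equality). -/
def comp (Ψ : Fock) (n : ℕ) : (Fin n → Mode) → ℂ :=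
  ((Ψ n : NPhoton n) : Lp ℂ 2 (confMeasure n))

theorem comp_add (Ψ Φ : Fock) (n : ℕ) :
    comp (Ψ + Φ) n =ᵐ[confMeasure n] fun x => comp Ψ n x + comp Φ n x :=
  Lp.coeFn_add _ _

theorem comp_smul (c : ℂ) (Ψ : Fock) (n : ℕ) :
    comp (c • Ψ) n =ᵐ[confMeasure n] fun x => c * comp Ψ n x :=
  Lp.coeFn_smul _ _

theorem comp_zero (n : ℕ) : comp 0 n =ᵐ[confMeasure n] fun _ => 0 :=
  Lp.coeFn_zero _ _ _

theorem eq_zero_of_comp {Ψ : Fock} (h : ∀ n, comp Ψ n =ᵐ[confMeasure n] fun _ => 0) : Ψ = 0 := by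
  refine lp.ext (funext fun n => Subtype.ext (Lp.ext ?_))
  exact (h n).trans (comp_zero n).symm

theorem ae_slice {n : ℕ} {u v : (Fin (n + 1) → Mode) → ℂ} (h : u =ᵐ[confMeasure (n + 1)] v) :
    ∀ᵐ x ∂(confMeasure n), ∀ᵐ y ∂modeMeasure, u (Fin.cons y x) = v (Fin.cons y x) := by
  have hmp := (measurePreserving_piFinSuccAbove (fun _ : Fin (n + 1) => modeMeasure) 0).symm
  have h1 := hmp.quasiMeasurePreserving.ae h
  have h2 := Measure.ae_ae_of_ae_prod (Measure.measurePreserving_swap.quasiMeasurePreserving.ae h1)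
  filter_upwards [h2] with x hx
  filter_upwards [hx] with y hy
  simpa [MeasurableEquiv.piFinSuccAbove, Fin.consEquiv] using hy

/-! ### Second quantization and annihilation operators -/

/-- The graph of `dΓ(φ)` for a real function `φ` of one photon variable: on the `n`-photon
component it is multiplication by `φ(x₁) + ⋯ + φ(xₙ)`. -/
def dGammaGraph (φ : Mode → ℝ) : Submodule ℂ (Fock × Fock) where
  carrier := {P | ∀ n, comp P.2 n =ᵐ[confMeasure n]
    fun x => ((∑ i, φ (x i) : ℝ) : ℂ) * comp P.1 n x}
  zero_mem' n := by
    filter_upwards [comp_zero n] with x hx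
    simp [hx]
  add_mem' {P Q} hP hQ n := by
    filter_upwards [hP n, hQ n, comp_add P.1 Q.1 n, comp_add P.2 Q.2 n] with x h1 h2 h3 h4
    simp only [Prod.fst_add, Prod.snd_add, h1, h2, h3, h4, mul_add]
  smul_mem' c P hP n := by
    filter_upwards [hP n, comp_smul c P.1 n, comp_smul c P.2 n] with x h1 h2 h3
    simp only [Prod.smul_fst, Prod.smul_snd, h1, h2, h3]
    ring

theorem dGammaGraph_singleValued (φ : Mode → ℝ) (P : Fock × Fock) (hP : P ∈ dGammaGraph φ)
    (h0 : P.1 = 0) : P.2 = 0 :=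
  eq_zero_of_comp fun n => by
    have hP' := hP n
    rw [h0] at hP'
    filter_upwards [hP', comp_zero n] with x h1 h2
    rw [h1, h2, mul_zero]

/-- The second quantization `dΓ(φ)` of multiplication by the real function `φ`, on its maximal
domain. -/
def dGamma (φ : Mode → ℝ) : Fock →ₗ.[ℂ] Fock := (dGammaGraph φ).toLinearPMap

theorem dGamma_graph (φ : Mode → ℝ) : (dGamma φ).graph = dGammaGraph φ :=
  Submodule.toLinearPMap_graph_eq _ (dGammaGraph_singleValued φ)

/-- The graph of the annihilation operator `a(f)`:
`(a(f)Ψ)ₙ(x) = √(n+1) ∫ conj (f y) Ψₙ₊₁(y, x) dy`.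
(For square integrable `f` the integrability clause holds automatically.) -/
def annihilationGraph (f : Mode → ℂ) : Submodule ℂ (Fock × Fock) where
  carrier := {P | ∀ n, ∀ᵐ x ∂(confMeasure n),
    Integrable (fun y => starRingEnd ℂ (f y) * comp P.1 (n + 1) (Fin.cons y x)) modeMeasure ∧
    comp P.2 n x = (Real.sqrt (n + 1) : ℂ) *
      ∫ y, starRingEnd ℂ (f y) * comp P.1 (n + 1) (Fin.cons y x) ∂modeMeasure}
  zero_mem' n := by
    filter_upwards [comp_zero n, ae_slice (comp_zero (n + 1))] with x hx hy
    have hz : (fun y => starRingEnd ℂ (f y) * comp 0 (n + 1) (Fin.cons y x))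
        =ᵐ[modeMeasure] fun _ => 0 := by
      filter_upwards [hy] with y hy
      rw [hy, mul_zero]
    refine ⟨(integrable_congr hz).2 (integrable_zero _ _ _), ?_⟩
    simp only [Prod.fst_zero, Prod.snd_zero]
    rw [hx, integral_congr_ae hz]
    simp
  add_mem' {P Q} hP hQ n := by
    filter_upwards [hP n, hQ n, comp_add P.2 Q.2 n, ae_slice (comp_add P.1 Q.1 (n + 1))]
      with x h1 h2 h3 h4
    have hz : (fun y => starRingEnd ℂ (f y) * comp (P.1 + Q.1) (n + 1) (Fin.cons y x))
        =ᵐ[modeMeasure] fun y => starRingEnd ℂ (f y) * comp P.1 (n + 1) (Fin.cons y x)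
          + starRingEnd ℂ (f y) * comp Q.1 (n + 1) (Fin.cons y x) := by
      filter_upwards [h4] with y hy
      rw [hy, mul_add]
    refine ⟨(integrable_congr hz).2 (h1.1.add h2.1), ?_⟩
    simp only [Prod.fst_add, Prod.snd_add]
    rw [h3, integral_congr_ae hz, integral_add h1.1 h2.1, h1.2, h2.2, mul_add]
  smul_mem' c P hP n := by
    filter_upwards [hP n, comp_smul c P.2 n, ae_slice (comp_smul c P.1 (n + 1))] with x h1 h3 h4
    have hz : (fun y => starRingEnd ℂ (f y) * comp (c • P.1) (n + 1) (Fin.cons y x))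
        =ᵐ[modeMeasure] fun y =>
          c * (starRingEnd ℂ (f y) * comp P.1 (n + 1) (Fin.cons y x)) := by
      filter_upwards [h4] with y hy
      rw [hy]
      ring
    refine ⟨(integrable_congr hz).2 (h1.1.const_mul c), ?_⟩
    simp only [Prod.smul_fst, Prod.smul_snd]
    rw [h3, integral_congr_ae hz, integral_const_mul, h1.2]
    ring

theorem annihilationGraph_singleValued (f : Mode → ℂ) (P : Fock × Fock)
    (hP : P ∈ annihilationGraph f) (h0 : P.1 = 0) : P.2 = 0 :=
  eq_zero_of_comp fun n => by
    have hP' := hP n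
    rw [h0] at hP'
    filter_upwards [hP', ae_slice (comp_zero (n + 1))] with x h1 h2
    have hz : (fun y => starRingEnd ℂ (f y) * comp 0 (n + 1) (Fin.cons y x))
        =ᵐ[modeMeasure] fun _ => 0 := by
      filter_upwards [h2] with y hy
      rw [hy, mul_zero]
    rw [h1.2, integral_congr_ae hz]
    simp

/-- The annihilation operator `a(f)`, antilinear in `f`, on its maximal domain. -/
def annihilation (f : Mode → ℂ) : Fock →ₗ.[ℂ] Fock := (annihilationGraph f).toLinearPMap

theorem annihilation_graph (f : Mode → ℂ) : (annihilation f).graph = annihilationGraph f :=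
  Submodule.toLinearPMap_graph_eq _ (annihilationGraph_singleValued f)

/-- The creation operator `a(f)*`, the Hilbert space adjoint of `a(f)`. -/
def creation (f : Mode → ℂ) : Fock →ₗ.[ℂ] Fock := (annihilation f).adjoint

/-! ### The quantized vector potential -/

/-- Polarization vectors: for every `k`, the vectors `e 0 k`, `e 1 k` are orthonormal and
orthogonal to `k`, and they are Borel measurable in `k`. -/
structure IsPolarization (e : Fin 2 → Momentum → Momentum) : Prop where
  measurable : ∀ l, Measurable (e l)
  orthonormal : ∀ k, Orthonormal ℝ fun l => e l k
  transversal : ∀ l k, inner ℝ (e l k) k = 0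

/-- The form factor `g_j(k, λ) = |k|^{-1/2} ρ(k) e_j^{(λ)}(k)` (at position `x = 0`). -/
def formFactor (ρ : Momentum → ℂ) (e : Fin 2 → Momentum → Momentum) (j : Fin 3) : Mode → ℂ :=
  fun x => ((‖x.1‖ ^ (-(1 / 2) : ℝ) : ℝ) : ℂ) * ρ x.1 * ((e x.2 x.1 j : ℝ) : ℂ)

/-- `A_j`, equal to `1/√2` times the closure of `a(g_j) + a(g_j)*`. -/
def vectorPotential (ρ : Momentum → ℂ) (e : Fin 2 → Momentum → Momentum) (j : Fin 3) :
    Fock →ₗ.[ℂ] Fock :=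
  ((1 / Real.sqrt 2 : ℝ) : ℂ) •
    (annihilation (formFactor ρ e j) + creation (formFactor ρ e j)).closure

/-! ### The Dirac polaron Hamiltonian on `ℂ⁴ ⊗ Fock` -/

/-- Dirac matrices: Hermitian `4 × 4` matrices with `α_j α_l + α_l α_j = 2 δ_{jl}`,
`α_j β + β α_j = 0`, `β² = 1`. -/
structure IsDirac (α : Fin 3 → Matrix (Fin 4) (Fin 4) ℂ) (β : Matrix (Fin 4) (Fin 4) ℂ) :
    Prop where
  hermitian_alpha : ∀ j, (α j).IsHermitian
  hermitian_beta : β.IsHermitian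
  anticomm_alpha : ∀ j l, α j * α l + α l * α j = if j = l then 2 else 0
  anticomm_beta : ∀ j, α j * β + β * α j = 0
  sq_beta : β * β = 1

/-- The Hilbert space `ℂ⁴ ⊗ Fock`, as four-component vectors with entries in the Fock space. -/
abbrev SpinorFock : Type := PiLp 2 fun _ : Fin 4 => Fock

/-- The operator `S ⊗ 1` for a `4 × 4` matrix `S`. -/
def spin (S : Matrix (Fin 4) (Fin 4) ℂ) : SpinorFock →ₗ[ℂ] SpinorFock where
  toFun Ψ := WithLp.toLp 2 fun a => ∑ b, S a b • Ψ b
  map_add' Ψ Φ := by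
    ext1 a
    simp [smul_add, Finset.sum_add_distrib]
  map_smul' c Ψ := by
    ext1 a
    simp [Finset.smul_sum, smul_comm c]

/-- The operator `1 ⊗ B` for an operator `B` in the Fock space. -/
def amplify (B : Fock →ₗ.[ℂ] Fock) : SpinorFock →ₗ.[ℂ] SpinorFock where
  domain :=
    { carrier := {Ψ | ∀ a, Ψ a ∈ B.domain}
      zero_mem' := fun _ => B.domain.zero_mem
      add_mem' := fun hΨ hΦ a => B.domain.add_mem (hΨ a) (hΦ a)
      smul_mem' := fun c _ hΨ a => B.domain.smul_mem c (hΨ a) }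
  toFun :=
    { toFun := fun Ψ => WithLp.toLp 2 fun a => B ⟨Ψ.1 a, Ψ.2 a⟩
      map_add' := fun Ψ Φ => by
        ext1 a
        exact B.map_add ⟨Ψ.1 a, Ψ.2 a⟩ ⟨Φ.1 a, Φ.2 a⟩
      map_smul' := fun c Ψ => by
        ext1 a
        exact B.map_smul c ⟨Ψ.1 a, Ψ.2 a⟩ }

/-- `H_m(p) = α·p + M β + dΓ(ω_m) - α·dΓ(k) - q α·A` with `ω_m(k) = (1 + m)|k| + m`,
on the intersection of the domains of its terms. -/
def hamiltonian (α : Fin 3 → Matrix (Fin 4) (Fin 4) ℂ) (β : Matrix (Fin 4) (Fin 4) ℂ)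
    (e : Fin 2 → Momentum → Momentum) (ρ : Momentum → ℂ) (M q m : ℝ) (p : Momentum) :
    SpinorFock →ₗ.[ℂ] SpinorFock :=
  (spin (∑ j, (p j : ℂ) • α j + (M : ℂ) • β)).toPMap ⊤
    + amplify (dGamma fun x => (1 + m) * ‖x.1‖ + m)
    - ∑ j, (spin (α j)).compPMap (amplify (dGamma fun x => x.1 j))
    - (q : ℂ) • ∑ j, (spin (α j)).compPMap (amplify (vectorPotential ρ e j))

/-- The spectrum of an operator `T`: those `z ∈ ℂ` for which `T - z` does not have an everywhere
defined bounded two-sided inverse `R`. -/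
def opSpectrum {E : Type*} [NormedAddCommGroup E] [NormedSpace ℂ E] (T : E →ₗ.[ℂ] E) : Set ℂ :=
  {z | ¬ ∃ R : E →L[ℂ] E, (∀ y, ∃ h : R y ∈ T.domain, T ⟨R y, h⟩ - z • R y = y) ∧
    ∀ x : T.domain, R (T x - z • (x : E)) = x}

/-- The lowest energy `E_m(p) = inf σ(closure of H_m(p))`, the infimum being taken in the extended
real numbers. -/
def lowestEnergy (α : Fin 3 → Matrix (Fin 4) (Fin 4) ℂ) (β : Matrix (Fin 4) (Fin 4) ℂ)
    (e : Fin 2 → Momentum → Momentum) (ρ : Momentum → ℂ) (M q m : ℝ) (p : Momentum) : EReal :=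
  ⨅ z ∈ opSpectrum (hamiltonian α β e ρ M q m p).closure, (z.re : EReal)

end DiracPolaron

end

/-!
The energy `E_m(p)` is an even and concave function of `p`, and such a function is largest at `0`.

*Concavity.* `H_m(p) = H_m(0) + α·p` is affine in `p` with a fixed domain, so its lowest energy is
an infimum of affine functions, as soon as the lowest energy is the infimum of the quadratic form.

*Evenness.* The parity `β ⊗ Γ(u)` maps `H_m(p)` to `H_m(-p)`. Here `β` anticommutes with `α_j`, and
`u` is the one-photon unitary involution
`(u f)(k, l) = -θ(k) ∑ₙ ⟨e l k, e n (-k)⟩ f(-k, n)` with the phase `θ(k) = ρ(k) / ρ(-k)`. It reverses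
`k`, preserves `|k|`, and maps every form factor `g_j` to `-g_j`, because the vectors `e n (-k)` span
the plane orthogonal to `k` (`IsPolarization.sum_inner_smul`). Hence `Γ(u)` anticommutes with
`dΓ(k_j)` and with `a(g_j)`, therefore with the adjoint and with `A_j`. To write `Γ(u)` on functions
of `n` photon variables, `u` is decomposed according to the shift `s` of the polarization index; then
`Γ(u)` is a sum of multiplication operators composed with measure preserving reflections
(`IsParity.onFock`).

*Spectrum and form.* Essential self-adjointness of `H_m(p)` is not needed. It suffices that `H_m(p)`
is symmetric, which rests on `a(g_j)` being densely defined (`dense_annihilation_domain`). If the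
spectrum of the closure of `H_m(p)` lies in `re z ≥ c`, then its resolvents at real points left of
`c` are bounded self-adjoint operators without negative spectrum, and so `H_m(p) ≥ c` as a quadratic
form (`lowerBound_of_spectrum`). By parity also `H_m(-p) ≥ c`, and the mean gives `H_m(0) ≥ c`.
Conversely the Neumann series for the bounded perturbation `-α·p` yields resolvents of `H_m(0)` at
very negative points, and a second one extends them to the whole half plane `re z < c`
(`spectrum_ge_of_vadd`).
-/

noncomputable section

namespace DiracPolaron

/-! ### Resolvents, lower bounds and closures of symmetric operators -/

section Abstract

variable {E : Type*} [NormedAddCommGroup E] [InnerProductSpace ℂ E]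

/-- `R` is the bounded everywhere defined two-sided inverse of `T - z`. -/
def IsResolvent (T : E →ₗ.[ℂ] E) (z : ℂ) (R : E →L[ℂ] E) : Prop :=
  (∀ y, ∃ h : R y ∈ T.domain, T ⟨R y, h⟩ - z • R y = y) ∧
    ∀ x : T.domain, R (T x - z • (x : E)) = x

theorem notMem_opSpectrum_iff {T : E →ₗ.[ℂ] E} {z : ℂ} :
    z ∉ opSpectrum T ↔ ∃ R, IsResolvent T z R := by
  simp only [opSpectrum, Set.mem_ofPred_eq, not_not, IsResolvent]

/-- The Neumann series `R (1 + B R)⁻¹` for the resolvent of a bounded perturbation. -/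
theorem IsResolvent.exists_vadd [CompleteSpace E] {T : E →ₗ.[ℂ] E} {z : ℂ} {R : E →L[ℂ] E}
    (hR : IsResolvent T z R) (B : E →L[ℂ] E) (hB : ‖B‖ * ‖R‖ < 1) :
    ∃ R', IsResolvent ((B : E →ₗ[ℂ] E) +ᵥ T) z R' := by
  have hlt : ‖-(B * R)‖ < 1 := by
    rw [norm_neg]
    exact (norm_mul_le B R).trans_lt hB
  set u := Units.oneSub (-(B * R)) hlt with hu
  have hval : ∀ y, (u : E →L[ℂ] E) y = y + B (R y) := fun y => by
    simp [hu]
  have h1 : ∀ y, (↑u⁻¹ : E →L[ℂ] E) y + B (R ((↑u⁻¹ : E →L[ℂ] E) y)) = y := fun y => by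
    rw [← hval, ← mul_apply_eq_comp, u.mul_inv, one_apply_eq_self]
  have h2 : ∀ y, (↑u⁻¹ : E →L[ℂ] E) (y + B (R y)) = y := fun y => by
    rw [← hval, ← mul_apply_eq_comp, u.inv_mul, one_apply_eq_self]
  refine ⟨R * (↑u⁻¹ : E →L[ℂ] E), fun y => ?_, fun x => ?_⟩
  · obtain ⟨h, hy⟩ := hR.1 ((↑u⁻¹ : E →L[ℂ] E) y)
    refine ⟨h, ?_⟩
    rw [LinearPMap.vadd_apply]
    simp only [mul_apply_eq_comp, ContinuousLinearMap.coe_coe]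
    rw [add_sub_assoc]
    refine Eq.trans ?_ (h1 y)
    rw [add_comm]
    congr 1
  · have hx := hR.2 x
    rw [LinearPMap.vadd_apply]
    simp only [mul_apply_eq_comp, ContinuousLinearMap.coe_coe]
    have : (B x + T x - z • (x : E)) = (T x - z • (x : E)) + B (R (T x - z • (x : E))) := by
      rw [hx]; abel
    rw [this, h2, hx]

/-- The Neumann series around `z`: the resolvent set contains the disk of radius `‖R‖⁻¹`. -/
theorem IsResolvent.exists_shift [CompleteSpace E] {T : E →ₗ.[ℂ] E} {z w : ℂ} {R : E →L[ℂ] E}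
    (hR : IsResolvent T z R) (hw : ‖z - w‖ * ‖R‖ < 1) : ∃ R', IsResolvent T w R' := by
  have hB : ‖(z - w) • (1 : E →L[ℂ] E)‖ ≤ ‖z - w‖ := by
    rw [norm_smul]
    exact mul_le_of_le_one_right (norm_nonneg _) ContinuousLinearMap.norm_id_le
  obtain ⟨R', h1, h2⟩ := hR.exists_vadd ((z - w) • (1 : E →L[ℂ] E))
    ((mul_le_mul_of_nonneg_right hB (norm_nonneg _)).trans_lt hw)
  have key : ∀ x : T.domain, ((((z - w) • (1 : E →L[ℂ] E) : E →L[ℂ] E) : E →ₗ[ℂ] E) +ᵥ T) x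
      - z • (x : E) = T x - w • (x : E) := fun x => by
    rw [LinearPMap.vadd_apply]
    simp [sub_smul]
    abel
  refine ⟨R', fun y => ?_, fun x => ?_⟩
  · obtain ⟨h, hy⟩ := h1 y
    exact ⟨h, (key ⟨R' y, h⟩).symm.trans hy⟩
  · rw [← key]
    exact h2 x

/-- The resolvent of a symmetric operator at a real point is symmetric. -/
theorem IsResolvent.isSymmetric {T : E →ₗ.[ℂ] E} (hT : T.IsFormalAdjoint T) {x : ℝ}
    {R : E →L[ℂ] E} (hR : IsResolvent T x R) : (R : E →ₗ[ℂ] E).IsSymmetric := by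
  intro y y'
  obtain ⟨h, hy⟩ := hR.1 y
  obtain ⟨h', hy'⟩ := hR.1 y'
  have := hT ⟨R y, h⟩ ⟨R y', h'⟩
  simp only [ContinuousLinearMap.coe_coe]
  conv_lhs => rw [← hy']
  conv_rhs => rw [← hy]
  rw [inner_sub_left, inner_sub_right, this, inner_smul_left, inner_smul_right]
  simp

/-- `T ≥ c` in the sense of quadratic forms. -/
def LowerBound (T : E →ₗ.[ℂ] E) (c : ℝ) : Prop :=
  ∀ x : T.domain, c * ‖(x : E)‖ ^ 2 ≤ (inner ℂ (T x) (x : E)).re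

/-- A symmetric operator whose spectrum lies in the half plane `re z ≥ c` is bounded from below by
`c`: its resolvent at a real point `l < c` is a bounded self-adjoint operator without negative
spectrum, since `R - μ = -μ R (T - l - μ⁻¹)`. -/
theorem lowerBound_of_spectrum [CompleteSpace E] {T : E →ₗ.[ℂ] E} (hT : T.IsFormalAdjoint T)
    {c : ℝ} (hc : ∀ z ∈ opSpectrum T, c ≤ z.re) : LowerBound T c := by
  have hres : ∀ z : ℂ, z.re < c → ∃ R, IsResolvent T z R := fun z hz =>
    notMem_opSpectrum_iff.1 fun h => (hc z h).not_gt hz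
  -- the bound by every `l < c` suffices
  have main : ∀ l : ℝ, l < c → LowerBound T l := by
    intro l hl
    obtain ⟨R, hR⟩ := hres l (by simpa using hl)
    have hsa : IsSelfAdjoint R :=
      ContinuousLinearMap.isSelfAdjoint_iff_isSymmetric.2 (hR.isSymmetric hT)
    have hpos : 0 ≤ R := by
      rw [StarOrderedRing.nonneg_iff_spectrum_nonneg (R := ℝ) R hsa]
      intro μ hμ
      by_contra hneg
      push Not at hneg
      apply hμ
      obtain ⟨Q, hQ⟩ := hres ((l : ℂ) + (μ : ℂ)⁻¹) (by
        rw [← Complex.ofReal_inv, ← Complex.ofReal_add, Complex.ofReal_re]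
        have := inv_lt_zero.2 hneg
        linarith)
      have hμ0 : (μ : ℂ) ≠ 0 := by exact_mod_cast hneg.ne
      -- the inverse of `μ - R` is `μ⁻¹ (1 + μ⁻¹ Q)`
      have e1 : ∀ y, R (y + (μ : ℂ)⁻¹ • Q y) = Q y := fun y => by
        obtain ⟨h, hy⟩ := hQ.1 y
        refine Eq.trans (congrArg R ?_) (hR.2 ⟨Q y, h⟩)
        nth_rewrite 1 [← hy]
        rw [add_smul]
        abel
      have e2 : ∀ y, y - (μ : ℂ)⁻¹ • R y = T ⟨R y, (hR.1 y).1⟩ - ((l : ℂ) + (μ : ℂ)⁻¹) • R y :=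
        fun y => by
          obtain ⟨h, hy⟩ := hR.1 y
          nth_rewrite 1 [← hy]
          rw [add_smul]
          abel
      have e3 : ∀ y, Q (y - (μ : ℂ)⁻¹ • R y) = R y := fun y => by
        rw [e2]
        exact hQ.2 _
      refine ⟨⟨algebraMap ℝ (E →L[ℂ] E) μ - R, (μ : ℂ)⁻¹ • (1 + (μ : ℂ)⁻¹ • Q), ?_, ?_⟩, rfl⟩
      · ext y
        have := e1 y
        simp only [mul_apply_eq_comp, _root_.sub_apply,
          _root_.smul_apply, _root_.add_apply,
          one_apply_eq_self, map_smul, this, Algebra.algebraMap_eq_smul_one]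
        rw [← Complex.coe_smul, smul_add, smul_smul, mul_inv_cancel₀ hμ0, one_smul,
          add_sub_cancel_right, smul_smul, inv_mul_cancel₀ hμ0, one_smul]
      · ext y
        have := e3 y
        simp only [mul_apply_eq_comp, _root_.sub_apply,
          _root_.smul_apply, _root_.add_apply,
          one_apply_eq_self, Algebra.algebraMap_eq_smul_one]
        rw [← Complex.coe_smul]
        have h3 : Q ((μ : ℂ) • y - R y) = (μ : ℂ) • R y := by
          conv_rhs => rw [← this, ← map_smul Q, smul_sub, smul_smul, mul_inv_cancel₀ hμ0, one_smul]
        rw [h3, smul_smul, inv_mul_cancel₀ hμ0, one_smul, sub_add_cancel, smul_smul,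
          inv_mul_cancel₀ hμ0, one_smul]
    intro x
    have hp := (ContinuousLinearMap.nonneg_iff_isPositive R).1 hpos
    have h := hp.re_inner_nonneg_left (T x - (l : ℂ) • (x : E))
    rw [hR.2 x, inner_sub_right, inner_smul_right, inner_self_eq_norm_sq_to_K] at h
    have h2 : (inner ℂ (T x) (x : E)).re = (inner ℂ (x : E) (T x)).re := by
      rw [← inner_conj_symm, Complex.conj_re]
    rw [h2]
    simp only [map_sub, RCLike.re_to_complex] at h
    have h3 : ((l : ℂ) * ((‖(x : E)‖ : ℂ)) ^ 2).re = l * ‖(x : E)‖ ^ 2 := by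
      rw [← Complex.ofReal_pow, ← Complex.ofReal_mul, Complex.ofReal_re]
    have h4 : ((l : ℂ) * (((‖(x : E)‖ : ℝ) : ℂ)) ^ 2).re ≤ (inner ℂ (x : E) (T x)).re := by
      simpa using h
    linarith
  intro x
  refine le_of_forall_pos_le_add fun ε hε => ?_
  have hn : 0 < ‖(x : E)‖ ^ 2 + 1 := by positivity
  have := main (c - ε / (‖(x : E)‖ ^ 2 + 1)) (by have := div_pos hε hn; linarith) x
  have h2 : ε / (‖(x : E)‖ ^ 2 + 1) * ‖(x : E)‖ ^ 2 ≤ ε := by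
    rw [div_mul_eq_mul_div, div_le_iff₀ hn]
    nlinarith
  nlinarith

/-- The resolvent estimate to the left of a lower bound: `(c - x) ‖u‖² ≤ ⟨(T - x) u, u⟩`. -/
theorem IsResolvent.norm_le {T : E →ₗ.[ℂ] E} {c x : ℝ} (hT : LowerBound T c) (hx : x < c)
    {R : E →L[ℂ] E} (hR : IsResolvent T x R) : ‖R‖ ≤ (c - x)⁻¹ := by
  have hcx : 0 < c - x := sub_pos.2 hx
  refine R.opNorm_le_bound (inv_nonneg.2 hcx.le) fun y => ?_
  obtain ⟨h, hy⟩ := hR.1 y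
  have h1 := hT ⟨R y, h⟩
  have h2 : (inner ℂ y (R y)).re = (inner ℂ (T ⟨R y, h⟩) (R y)).re - x * ‖R y‖ ^ 2 := by
    nth_rewrite 1 [← hy]
    rw [inner_sub_left, inner_smul_left, inner_self_eq_norm_sq_to_K, Complex.sub_re]
    congr 1
    simp [← Complex.ofReal_pow]
  have h3 : (inner ℂ y (R y)).re ≤ ‖y‖ * ‖R y‖ :=
    (Complex.re_le_norm _).trans (norm_inner_le_norm _ _)
  rw [inv_mul_eq_div, le_div_iff₀ hcx]
  simp only at h1
  rcases (norm_nonneg (R y)).eq_or_lt with h0 | h0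
  · rw [← h0]; simp
  · refine le_of_mul_le_mul_right ?_ h0
    nlinarith

/-- If an operator that is bounded from below by `c` has resolvents at all very negative real
numbers, then its spectrum lies in the half plane `re z ≥ c`: the disks of radius `c - x`
around these numbers `x` exhaust the complementary half plane. -/
theorem spectrum_ge_of_lowerBound [CompleteSpace E] {T : E →ₗ.[ℂ] E} {c K : ℝ}
    (hT : LowerBound T c) (hres : ∀ x : ℝ, x < K → ∃ R, IsResolvent T x R) :
    ∀ z ∈ opSpectrum T, c ≤ z.re := by
  intro z hz
  by_contra hlt
  push Not at hlt
  refine notMem_opSpectrum_iff.2 ?_ hz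
  have hd : 0 < c - z.re := sub_pos.2 hlt
  -- `‖x - z‖² < (c - x)²` is a linear condition on `x`, satisfied by all very negative `x`
  set x : ℝ := min (min K z.re - 1) (z.re - z.im ^ 2 / (c - z.re)) with hxdef
  have hxK : x < K := by
    have h1 := min_le_left (min K z.re - 1) (z.re - z.im ^ 2 / (c - z.re))
    have h2 := min_le_left K z.re
    linarith
  have hxz : x < z.re := by
    have h1 := min_le_left (min K z.re - 1) (z.re - z.im ^ 2 / (c - z.re))
    have h2 := min_le_right K z.re
    linarith
  have hxi : z.im ^ 2 ≤ (z.re - x) * (c - z.re) := by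
    have h1 := min_le_right (min K z.re - 1) (z.re - z.im ^ 2 / (c - z.re))
    rw [← div_le_iff₀ hd]
    linarith
  obtain ⟨R, hR⟩ := hres x hxK
  have hcx : 0 < c - x := by linarith
  refine hR.exists_shift ?_
  have hn : ‖(x : ℂ) - z‖ < c - x := by
    rw [← abs_of_pos hcx, ← abs_of_nonneg (norm_nonneg _), ← sq_lt_sq, ← Complex.normSq_eq_norm_sq,
      Complex.normSq_apply]
    simp only [Complex.sub_re, Complex.ofReal_re, Complex.sub_im, Complex.ofReal_im]
    nlinarith
  calc ‖(x : ℂ) - z‖ * ‖R‖ ≤ ‖(x : ℂ) - z‖ * (c - x)⁻¹ :=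
        mul_le_mul_of_nonneg_left (hR.norm_le hT (by linarith)) (norm_nonneg _)
    _ < 1 := by rwa [← div_eq_mul_inv, div_lt_one hcx]

theorem mem_graph_vadd {B : E →ₗ[ℂ] E} {T : E →ₗ.[ℂ] E} {P : E × E} :
    P ∈ (B +ᵥ T).graph ↔ (P.1, P.2 - B P.1) ∈ T.graph := by
  simp only [LinearPMap.mem_graph_iff]
  constructor
  · rintro ⟨y, hy, hy2⟩
    refine ⟨y, hy, ?_⟩
    rw [← hy2, ← hy, LinearPMap.vadd_apply]
    abel
  · rintro ⟨y, hy, hy2⟩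
    refine ⟨y, hy, ?_⟩
    rw [LinearPMap.vadd_apply, hy2, hy]
    abel

theorem graph_vadd_topologicalClosure (B : E →L[ℂ] E) {T : E →ₗ.[ℂ] E} (hT : T.IsClosable) :
    ((B : E →ₗ[ℂ] E) +ᵥ T).graph.topologicalClosure = ((B : E →ₗ[ℂ] E) +ᵥ T.closure).graph := by
  let φ : E × E ≃ₜ E × E :=
    { toFun := fun P => (P.1, P.2 - B P.1)
      invFun := fun P => (P.1, P.2 + B P.1)
      left_inv := fun P => by simp
      right_inv := fun P => by simp
      continuous_toFun := by fun_prop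
      continuous_invFun := by fun_prop }
  have h : ∀ S : E →ₗ.[ℂ] E, (((B : E →ₗ[ℂ] E) +ᵥ S).graph : Set (E × E)) = φ ⁻¹' S.graph := by
    intro S
    ext P
    exact mem_graph_vadd
  apply SetLike.coe_injective
  rw [Submodule.topologicalClosure_coe, h, h, ← hT.graph_closure_eq_closure_graph,
    Submodule.topologicalClosure_coe, φ.preimage_closure]

theorem IsClosable.vadd (B : E →L[ℂ] E) {T : E →ₗ.[ℂ] E} (hT : T.IsClosable) :
    ((B : E →ₗ[ℂ] E) +ᵥ T).IsClosable :=
  ⟨_, graph_vadd_topologicalClosure B hT⟩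

theorem neg_vadd_vadd_cancel (B : E →L[ℂ] E) (T : E →ₗ.[ℂ] E) :
    (((-B : E →L[ℂ] E) : E →ₗ[ℂ] E) +ᵥ ((B : E →ₗ[ℂ] E) +ᵥ T)) = T := by
  rw [ContinuousLinearMap.toLinearMap_neg, neg_vadd_vadd]

/-- Adding a bounded operator commutes with taking closures. This includes operators that are not
closable, which are their own closures by convention. -/
theorem closure_vadd (B : E →L[ℂ] E) (T : E →ₗ.[ℂ] E) :
    ((B : E →ₗ[ℂ] E) +ᵥ T).closure = (B : E →ₗ[ℂ] E) +ᵥ T.closure := by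
  by_cases hT : T.IsClosable
  · apply LinearPMap.eq_of_eq_graph
    rw [← (IsClosable.vadd B hT).graph_closure_eq_closure_graph,
      graph_vadd_topologicalClosure B hT]
  · have : ¬ ((B : E →ₗ[ℂ] E) +ᵥ T).IsClosable := fun h => hT (by
      have := IsClosable.vadd (-B) h
      rwa [neg_vadd_vadd_cancel] at this)
    rw [LinearPMap.closure_def' hT, LinearPMap.closure_def' this]

/-- Closed conditions on the graph of an operator pass to its closure. -/
theorem forall_closure_graph {T : E →ₗ.[ℂ] E} {C : Set (E × E)} (hC : IsClosed C)
    (h : ∀ P ∈ T.graph, P ∈ C) : ∀ P ∈ T.closure.graph, P ∈ C := by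
  by_cases hT : T.IsClosable
  · rw [← hT.graph_closure_eq_closure_graph]
    exact fun P hP => closure_minimal h hC hP
  · rwa [LinearPMap.closure_def' hT]

theorem isFormalAdjoint_iff_graph {T : E →ₗ.[ℂ] E} : T.IsFormalAdjoint T ↔
    ∀ P ∈ T.graph, ∀ Q ∈ T.graph, inner ℂ P.2 Q.1 = inner ℂ P.1 Q.2 := by
  constructor
  · intro h P hP Q hQ
    obtain ⟨x, hx, hx2⟩ := (LinearPMap.mem_graph_iff _).1 hP
    obtain ⟨y, hy, hy2⟩ := (LinearPMap.mem_graph_iff _).1 hQ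
    rw [← hx, ← hx2, ← hy, ← hy2]
    exact h x y
  · exact fun h x y => h _ (T.mem_graph x) _ (T.mem_graph y)

theorem isFormalAdjoint_closure {T : E →ₗ.[ℂ] E} (hT : T.IsFormalAdjoint T) :
    T.closure.IsFormalAdjoint T.closure := by
  rw [isFormalAdjoint_iff_graph] at hT ⊢
  have h1 : ∀ P ∈ T.closure.graph, ∀ Q ∈ T.graph, inner ℂ P.2 Q.1 = inner ℂ P.1 Q.2 := by
    intro P hP Q hQ
    exact forall_closure_graph (C := {P | inner ℂ P.2 Q.1 = inner ℂ P.1 Q.2})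
      (isClosed_eq (by fun_prop) (by fun_prop)) (fun P hP => hT P hP Q hQ) P hP
  intro P hP
  exact forall_closure_graph (C := {Q | inner ℂ P.2 Q.1 = inner ℂ P.1 Q.2})
    (isClosed_eq (by fun_prop) (by fun_prop)) (fun Q hQ => h1 P hP Q hQ)

theorem lowerBound_iff_graph {T : E →ₗ.[ℂ] E} {c : ℝ} : LowerBound T c ↔
    ∀ P ∈ T.graph, c * ‖P.1‖ ^ 2 ≤ (inner ℂ P.2 P.1).re := by
  constructor
  · intro h P hP
    obtain ⟨x, hx, hx2⟩ := (LinearPMap.mem_graph_iff _).1 hP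
    rw [← hx, ← hx2]
    exact h x
  · exact fun h x => h _ (T.mem_graph x)

theorem LowerBound.closure {T : E →ₗ.[ℂ] E} {c : ℝ} (hT : LowerBound T c) :
    LowerBound T.closure c := by
  rw [lowerBound_iff_graph] at hT ⊢
  exact forall_closure_graph (C := {P | c * ‖P.1‖ ^ 2 ≤ (inner ℂ P.2 P.1).re})
    (isClosed_le (by fun_prop) (by fun_prop)) hT

/-- Let `T + B` be symmetric with bounded `B`, and let an isometry `U` intertwine `T - B` with
`T + B`. Then the lowest spectral point of `T` is at least that of `T + B`: both `T + B` and
`T - B` are bounded from below by `c`, hence so is their mean `T`, and the resolvents of `T + B` at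
very negative numbers give resolvents of `T`. -/
theorem spectrum_ge_of_vadd [CompleteSpace E] {T : E →ₗ.[ℂ] E} {B : E →L[ℂ] E} {U : E →ₗᵢ[ℂ] E}
    (hsymm : ((B : E →ₗ[ℂ] E) +ᵥ T).IsFormalAdjoint ((B : E →ₗ[ℂ] E) +ᵥ T))
    (hU : ∀ x : T.domain, ∃ h : U x ∈ T.domain, T ⟨U x, h⟩ + B (U x) = U (T x - B x)) {c : ℝ}
    (hc : ∀ z ∈ opSpectrum ((B : E →ₗ[ℂ] E) +ᵥ T).closure, c ≤ z.re) :
    ∀ z ∈ opSpectrum T.closure, c ≤ z.re := by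
  set S : E →ₗ.[ℂ] E := (B : E →ₗ[ℂ] E) +ᵥ T with hS
  have hSc : LowerBound S.closure c := lowerBound_of_spectrum (isFormalAdjoint_closure hsymm) hc
  have hplus : ∀ x : T.domain, c * ‖(x : E)‖ ^ 2 ≤ (inner ℂ (T x + B x) (x : E)).re := by
    intro x
    have hx := lowerBound_iff_graph.1 hSc (x, T x + B x)
      (LinearPMap.le_graph_of_le S.le_closure (mem_graph_vadd.2 (by simp)))
    exact hx
  have hminus : ∀ x : T.domain, c * ‖(x : E)‖ ^ 2 ≤ (inner ℂ (T x - B x) (x : E)).re := by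
    intro x
    obtain ⟨h, hx⟩ := hU x
    have := hplus ⟨U x, h⟩
    rwa [hx, U.norm_map, U.inner_map_map] at this
  have hT : LowerBound T c := by
    intro x
    have h1 := hplus x
    have h2 := hminus x
    rw [inner_add_left, Complex.add_re] at h1
    rw [inner_sub_left, Complex.sub_re] at h2
    linarith
  refine spectrum_ge_of_lowerBound (K := c - ‖B‖) hT.closure fun x hx => ?_
  have hxc : x < c := hx.trans_le (sub_le_self _ (norm_nonneg _))
  -- to the left of `c - ‖B‖` the Neumann series for `T = (T + B) - B` converges
  obtain ⟨R, hR⟩ := notMem_opSpectrum_iff.1 fun h => (hc x h).not_gt (by simpa using hxc)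
  have hTS : T.closure = ((-B : E →L[ℂ] E) : E →ₗ[ℂ] E) +ᵥ S.closure := by
    rw [← closure_vadd, hS, neg_vadd_vadd_cancel]
  rw [hTS]
  refine hR.exists_vadd _ ?_
  have hcx : 0 < c - x := sub_pos.2 hxc
  calc ‖-B‖ * ‖R‖ ≤ ‖B‖ * (c - x)⁻¹ := by
        rw [norm_neg]
        exact mul_le_mul_of_nonneg_left (hR.norm_le hSc hxc) (norm_nonneg _)
    _ < 1 := by
        rw [← div_eq_mul_inv, div_lt_one hcx]
        linarith

end Abstract

/-! ### Unitary involutions of `L²` built from reflections -/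

section Reflection

variable {X S : Type*} [MeasurableSpace X] [Fintype S]

/-- The weighted composition operator `F ↦ ∑ₛ cₛ · (F ∘ τₛ)`. -/
def weightedComp (c : S → X → ℂ) (τ : S → X → X) (F : X → ℂ) (x : X) : ℂ :=
  ∑ s, c s x * F (τ s x)

/-- Data for which `weightedComp c τ` is a self-adjoint unitary involution of `L²(μ)`. -/
structure IsReflection (μ : Measure X) (c : S → X → ℂ) (τ : S → X → X) : Prop where
  measurePreserving : ∀ s, MeasurePreserving (τ s) μ μ
  involutive : ∀ s x, τ s (τ s x) = x
  measurable : ∀ s, Measurable (c s)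
  norm_le : ∀ s x, ‖c s x‖ ≤ 1
  hermitian : ∀ s x, starRingEnd ℂ (c s (τ s x)) = c s x
  sq : ∀ F x, weightedComp c τ (weightedComp c τ F) x = F x

variable {μ : Measure X} {c : S → X → ℂ} {τ : S → X → X}

theorem IsReflection.ae (h : IsReflection μ c τ) {p : X → Prop} (hp : ∀ᵐ x ∂μ, p x) :
    ∀ᵐ x ∂μ, ∀ s, p (τ s x) :=
  ae_all_iff.2 fun s => (h.measurePreserving s).quasiMeasurePreserving.ae hp

theorem IsReflection.congr_ae (h : IsReflection μ c τ) {F G : X → ℂ} (hFG : F =ᵐ[μ] G) :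
    weightedComp c τ F =ᵐ[μ] weightedComp c τ G := by
  filter_upwards [h.ae hFG] with x hx
  simp only [weightedComp, hx]

theorem IsReflection.memLp_term (h : IsReflection μ c τ) {F : X → ℂ} (hF : MemLp F 2 μ) (s : S) :
    MemLp (fun x => c s x * F (τ s x)) 2 μ := by
  have h1 : MemLp (fun x => F (τ s x)) 2 μ := hF.comp_measurePreserving (h.measurePreserving s)
  refine h1.mono ((h.measurable s).aestronglyMeasurable.mul h1.1) (Filter.Eventually.of_forall ?_)
  intro x
  rw [norm_mul]
  exact mul_le_of_le_one_left (norm_nonneg _) (h.norm_le s x)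

theorem IsReflection.memLp (h : IsReflection μ c τ) {F : X → ℂ} (hF : MemLp F 2 μ) :
    MemLp (weightedComp c τ F) 2 μ :=
  memLp_finsetSum _ fun s _ => h.memLp_term hF s

theorem IsReflection.integral_comp (h : IsReflection μ c τ) (s : S) (G : X → ℂ) :
    ∫ x, G (τ s x) ∂μ = ∫ x, G x ∂μ := by
  let e : X ≃ᵐ X :=
    { toFun := τ s
      invFun := τ s
      left_inv := h.involutive s
      right_inv := h.involutive s
      measurable_toFun := (h.measurePreserving s).measurable
      measurable_invFun := (h.measurePreserving s).measurable }
  exact MeasurePreserving.integral_comp' (f := e) (h.measurePreserving s) G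

theorem integrable_conj_mul {F G : X → ℂ} (hF : MemLp F 2 μ) (hG : MemLp G 2 μ) :
    Integrable (fun x => starRingEnd ℂ (F x) * G x) μ :=
  MemLp.integrable_mul (p := 2) (q := 2) hF.star hG

/-- `weightedComp c τ` is self-adjoint on `L²`. -/
theorem IsReflection.symm (h : IsReflection μ c τ) {F G : X → ℂ} (hF : MemLp F 2 μ)
    (hG : MemLp G 2 μ) :
    ∫ x, starRingEnd ℂ (F x) * weightedComp c τ G x ∂μ
      = ∫ x, starRingEnd ℂ (weightedComp c τ F x) * G x ∂μ := by
  have hl : ∀ x, starRingEnd ℂ (F x) * weightedComp c τ G x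
      = ∑ s, starRingEnd ℂ (F x) * (c s x * G (τ s x)) := fun x => by
    rw [weightedComp, Finset.mul_sum]
  have hr : ∀ x, starRingEnd ℂ (weightedComp c τ F x) * G x
      = ∑ s, starRingEnd ℂ (c s x * F (τ s x)) * G x := fun x => by
    rw [weightedComp, map_sum, Finset.sum_mul]
  simp_rw [hl, hr]
  rw [integral_finsetSum _ fun s _ => integrable_conj_mul hF (h.memLp_term hG s),
    integral_finsetSum _ fun s _ => integrable_conj_mul (h.memLp_term hF s) hG]
  refine Finset.sum_congr rfl fun s _ => ?_
  rw [← h.integral_comp s]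
  refine integral_congr_ae (Filter.Eventually.of_forall fun x => ?_)
  simp only
  rw [h.involutive, map_mul, ← h.hermitian s x, Complex.conj_conj]
  ring

/-- The unitary operator on `L²` given by a reflection. -/
def IsReflection.toLp (h : IsReflection μ c τ) : Lp ℂ 2 μ →ₗᵢ[ℂ] Lp ℂ 2 μ where
  toFun f := (h.memLp (Lp.memLp f)).toLp
  map_add' f g := by
    rw [← MemLp.toLp_add, MemLp.toLp_eq_toLp_iff]
    filter_upwards [h.ae (Lp.coeFn_add f g)] with x hx
    simp only [weightedComp, hx, Pi.add_apply, mul_add, Finset.sum_add_distrib]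
  map_smul' a f := by
    rw [RingHom.id_apply, ← MemLp.toLp_const_smul, MemLp.toLp_eq_toLp_iff]
    filter_upwards [h.ae (Lp.coeFn_smul a f)] with x hx
    simp only [weightedComp, hx, Pi.smul_apply, smul_eq_mul, Finset.mul_sum]
    exact Finset.sum_congr rfl fun s _ => by ring
  norm_map' f := by
    have hf := Lp.memLp f
    set g : Lp ℂ 2 μ := (h.memLp hf).toLp with hg
    have key : (inner ℂ g g : ℂ) = inner ℂ f f := by
      rw [L2.inner_def, L2.inner_def]
      have e1 : ∀ᵐ x ∂μ, inner ℂ (g x) (g x)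
          = starRingEnd ℂ (weightedComp c τ f x) * weightedComp c τ f x := by
        filter_upwards [(h.memLp hf).coeFn_toLp] with x hx
        rw [hx, RCLike.inner_apply, mul_comm]
      rw [integral_congr_ae e1, h.symm (h.memLp hf) hf]
      refine integral_congr_ae (Filter.Eventually.of_forall fun x => ?_)
      simp only
      rw [h.sq, RCLike.inner_apply, mul_comm]
    change ‖g‖ = ‖f‖
    rw [inner_self_eq_norm_sq_to_K, inner_self_eq_norm_sq_to_K] at key
    exact (sq_eq_sq₀ (norm_nonneg _) (norm_nonneg _)).1 (by exact_mod_cast key)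

theorem IsReflection.coeFn_toLp (h : IsReflection μ c τ) (f : Lp ℂ 2 μ) :
    h.toLp f =ᵐ[μ] weightedComp c τ f :=
  (h.memLp (Lp.memLp f)).coeFn_toLp

end Reflection

/-! ### Second quantized parity on the Fock space -/

section Photon

/-- The reflection `(k, l) ↦ (-k, l + s)` of one photon variable. -/
def modeFlip (s : Fin 2) (x : Mode) : Mode := (-x.1, x.2 + s)

theorem Fin2.add_add (l s r : Fin 2) : l + s + (s + r) = l + r := by
  revert l s r; decide

theorem Fin2.add_self (l s : Fin 2) : l + s + s = l := by
  revert l s; decide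

theorem modeFlip_modeFlip (s : Fin 2) (x : Mode) : modeFlip s (modeFlip s x) = x :=
  Prod.ext (neg_neg _) (Fin2.add_self _ _)

theorem measurePreserving_modeFlip (s : Fin 2) :
    MeasurePreserving (modeFlip s) modeMeasure modeMeasure :=
  MeasurePreserving.prod (Measure.measurePreserving_neg volume)
    (measurePreserving_add_right Measure.count s)

/-- The coefficients `vₛ(k, l) = V(k)_{l, l + s}` of a one-photon parity: `V(k)` is unitary with
`V(k)* = V(-k)`, so that `f ↦ V(k) f(-k)` is a unitary involution. -/
structure IsParity (v : Fin 2 → Mode → ℂ) : Prop where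
  measurable : ∀ s, Measurable (v s)
  hermitian : ∀ s x, starRingEnd ℂ (v s (modeFlip s x)) = v s x
  sum_mul : ∀ r x, ∑ s, v s x * v (s + r) (modeFlip s x) = if r = 0 then 1 else 0

variable {v : Fin 2 → Mode → ℂ}

/-- The rows of a unitary matrix have entries of modulus at most one. -/
theorem IsParity.norm_le (hv : IsParity v) (s : Fin 2) (x : Mode) : ‖v s x‖ ≤ 1 := by
  have h := hv.sum_mul 0 x
  simp only [add_zero, if_true] at h
  have h2 : ∀ t, v t x * v t (modeFlip t x) = ((‖v t x‖ ^ 2 : ℝ) : ℂ) := fun t => by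
    rw [← Complex.conj_conj (v t (modeFlip t x)), hv.hermitian t x, Complex.mul_conj,
      Complex.normSq_eq_norm_sq]
  simp only [h2] at h
  have h3 : ∑ t, ‖v t x‖ ^ 2 = 1 := by exact_mod_cast h
  have h4 : ‖v s x‖ ^ 2 ≤ ∑ t, ‖v t x‖ ^ 2 :=
    Finset.single_le_sum (f := fun t => ‖v t x‖ ^ 2) (fun t _ => sq_nonneg _) (Finset.mem_univ s)
  rw [h3] at h4
  exact (sq_le_one_iff₀ (norm_nonneg _)).1 h4

/-- The coefficients of the `n`-fold tensor power of a one-photon parity. -/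
def confCoeff (v : Fin 2 → Mode → ℂ) {n : ℕ} (s : Fin n → Fin 2) (x : Fin n → Mode) : ℂ :=
  ∏ i, v (s i) (x i)

/-- The reflection of all photon variables. -/
def confFlip {n : ℕ} (s : Fin n → Fin 2) (x : Fin n → Mode) : Fin n → Mode :=
  fun i => modeFlip (s i) (x i)

theorem confFlip_confFlip {n : ℕ} (s : Fin n → Fin 2) (x : Fin n → Mode) :
    confFlip s (confFlip s x) = x :=
  funext fun _ => modeFlip_modeFlip _ _

theorem IsParity.isReflection_mode (hv : IsParity v) :
    IsReflection modeMeasure v modeFlip where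
  measurePreserving := measurePreserving_modeFlip
  involutive := modeFlip_modeFlip
  measurable := hv.measurable
  norm_le := hv.norm_le
  hermitian := hv.hermitian
  sq F x := by
    have h1 : ∀ s, ∑ t, v t (modeFlip s x) * F (modeFlip t (modeFlip s x))
        = ∑ r, v (s + r) (modeFlip s x) * F (x.1, x.2 + r) := fun s => by
      refine (Fintype.sum_equiv (Equiv.addLeft s) _ _ fun r => ?_).symm
      congr 2
      exact Prod.ext (neg_neg _).symm (Fin2.add_add _ _ _).symm
    simp only [weightedComp, h1, Finset.mul_sum]
    rw [Finset.sum_comm]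
    simp only [← mul_assoc, ← Finset.sum_mul, hv.sum_mul]
    simp

/-- The `n`-fold tensor power of a one-photon parity is again an involution: for fixed total shift
`r` the sum over intermediate shifts factorizes into one-photon sums. -/
theorem IsParity.isReflection (hv : IsParity v) (n : ℕ) :
    IsReflection (confMeasure n) (confCoeff v) (confFlip (n := n)) where
  measurePreserving s := measurePreserving_pi _ _ fun i => measurePreserving_modeFlip (s i)
  involutive := confFlip_confFlip
  measurable s := Finset.measurable_fun_prod _ fun i _ =>
    (hv.measurable (s i)).comp (measurable_pi_apply i)
  norm_le s x := by
    rw [confCoeff, norm_prod]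
    exact Finset.prod_le_one (fun _ _ => norm_nonneg _) fun i _ => hv.norm_le _ _
  hermitian s x := by
    simp only [confCoeff, map_prod]
    exact Finset.prod_congr rfl fun i _ => hv.hermitian _ _
  sq F x := by
    have h1 : ∀ s : Fin n → Fin 2, ∑ t, confCoeff v t (confFlip s x) * F (confFlip t (confFlip s x))
        = ∑ r, confCoeff v (s + r) (confFlip s x) * F (fun i => ((x i).1, (x i).2 + r i)) :=
      fun s => by
        refine (Fintype.sum_equiv (Equiv.addLeft s) _ _ fun r => ?_).symm
        congr 2
        funext i
        exact Prod.ext (neg_neg _).symm (Fin2.add_add _ _ _).symm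
    have h2 : ∀ r : Fin n → Fin 2, ∑ s, confCoeff v s x * confCoeff v (s + r) (confFlip s x)
        = if r = 0 then 1 else 0 := fun r => by
      simp only [confCoeff, ← Finset.prod_mul_distrib]
      have := Finset.prod_univ_sum (fun _ : Fin n => (Finset.univ : Finset (Fin 2)))
        (fun i s => v s (x i) * v (s + r i) (modeFlip s (x i)))
      rw [Fintype.piFinset_univ] at this
      refine Eq.trans this.symm ?_
      simp only [hv.sum_mul]
      split_ifs with h
      · exact Finset.prod_eq_one fun i _ => if_pos (congrFun h i)
      · obtain ⟨i, hi⟩ := Function.ne_iff.1 h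
        exact Finset.prod_eq_zero (Finset.mem_univ i) (if_neg hi)
    simp only [weightedComp, h1, Finset.mul_sum]
    rw [Finset.sum_comm]
    simp only [← mul_assoc, ← Finset.sum_mul, h2]
    simp

/-- The `n`-fold tensor power of a one-photon parity commutes with permutations. -/
theorem weightedComp_perm {n : ℕ} (F : (Fin n → Mode) → ℂ) (σ : Equiv.Perm (Fin n))
    (x : Fin n → Mode) :
    weightedComp (confCoeff v) confFlip F (x ∘ σ)
      = weightedComp (confCoeff v) confFlip (fun y => F (y ∘ σ)) x := by
  refine (Fintype.sum_equiv (σ.arrowCongr (Equiv.refl (Fin 2))) _ _ fun s => ?_)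
  have h1 : confCoeff v (σ.arrowCongr (Equiv.refl (Fin 2)) s) x = confCoeff v s (x ∘ σ) := by
    refine (Fintype.prod_equiv σ _ _ fun i => ?_).symm
    simp
  rw [h1]
  congr 2
  funext i
  simp [confFlip]

theorem mem_NPhoton_iff {n : ℕ} {f : Lp ℂ 2 (confMeasure n)} : f ∈ NPhoton n ↔
    ∀ σ : Equiv.Perm (Fin n), (fun x => f (x ∘ σ)) =ᵐ[confMeasure n] f := by
  simp only [NPhoton, Submodule.mem_iInf, LinearMap.mem_eqLocus, LinearMap.id_apply]
  refine forall_congr' fun σ => ?_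
  have h := Lp.coeFn_compMeasurePreserving f (measurePreserving_perm σ)
  constructor
  · intro hf
    have h2 : Lp.compMeasurePreserving (fun x : Fin n → Mode => x ∘ σ)
        (measurePreserving_perm σ) f = f := hf
    rw [h2] at h
    exact h.symm
  · intro hf
    exact Lp.ext (h.trans hf)

theorem IsParity.mapsTo_NPhoton (hv : IsParity v) {n : ℕ} {f : Lp ℂ 2 (confMeasure n)}
    (hf : f ∈ NPhoton n) : (hv.isReflection n).toLp f ∈ NPhoton n := by
  rw [mem_NPhoton_iff] at hf ⊢
  intro σ
  have h1 := (hv.isReflection n).coeFn_toLp f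
  have h2 := (measurePreserving_perm σ).quasiMeasurePreserving.ae h1
  filter_upwards [h1, h2, (hv.isReflection n).congr_ae (hf σ)] with x e1 e2 e3
  rw [e1, e2, weightedComp_perm, e3]

/-- The second quantized parity on the `n`-photon space. -/
def IsParity.onNPhoton (hv : IsParity v) (n : ℕ) : NPhoton n →ₗᵢ[ℂ] NPhoton n where
  toLinearMap := (hv.isReflection n).toLp.toLinearMap.restrict fun _ hf => hv.mapsTo_NPhoton hf
  norm_map' f := (hv.isReflection n).toLp.norm_map f

/-- The second quantization `⨁ₙ u ⊗ ⋯ ⊗ u` of a one-photon parity `u` on the Fock space. -/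
def IsParity.onFock (hv : IsParity v) : Fock →ₗᵢ[ℂ] Fock where
  toFun Ψ := ⟨fun n => hv.onNPhoton n (Ψ n), (lp.memℓp Ψ).mono' fun n =>
    ((hv.onNPhoton n).norm_map _).le⟩
  map_add' Ψ Φ := lp.ext (funext fun n => (hv.onNPhoton n).map_add _ _)
  map_smul' c Ψ := lp.ext (funext fun n => (hv.onNPhoton n).map_smul _ _)
  norm_map' Ψ := by
    rw [lp.norm_eq_tsum_rpow (by norm_num), lp.norm_eq_tsum_rpow (by norm_num)]
    simp only [LinearMap.coe_mk, AddHom.coe_mk, LinearIsometry.norm_map]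

theorem IsParity.comp_onFock (hv : IsParity v) (Ψ : Fock) (n : ℕ) :
    comp (hv.onFock Ψ) n =ᵐ[confMeasure n] weightedComp (confCoeff v) confFlip (comp Ψ n) :=
  (hv.isReflection n).coeFn_toLp _

theorem IsParity.onFock_onFock (hv : IsParity v) (Ψ : Fock) : hv.onFock (hv.onFock Ψ) = Ψ := by
  refine lp.ext (funext fun n => Subtype.ext (Lp.ext ?_))
  change comp (hv.onFock (hv.onFock Ψ)) n =ᵐ[confMeasure n] comp Ψ n
  filter_upwards [hv.comp_onFock (hv.onFock Ψ) n,
    (hv.isReflection n).congr_ae (hv.comp_onFock Ψ n)] with x h1 h2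
  rw [h1, h2, (hv.isReflection n).sq]

theorem IsParity.inner_onFock (hv : IsParity v) (Ψ Φ : Fock) :
    (inner ℂ (hv.onFock Ψ) Φ : ℂ) = inner ℂ Ψ (hv.onFock Φ) := by
  rw [← hv.onFock.inner_map_map, hv.onFock_onFock]

end Photon

/-! ### Slices of square integrable functions -/

section Slices

theorem memLp_prod_slice {X Y : Type*} [MeasurableSpace X] [MeasurableSpace Y] {μ : Measure X}
    {ν : Measure Y} [SFinite μ] [SFinite ν] {G : X × Y → ℂ} (hG : MemLp G 2 (μ.prod ν)) :
    ∀ᵐ x ∂μ, MemLp (fun y => G (x, y)) 2 ν := by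
  have h1 := (memLp_two_iff_integrable_sq_norm hG.1).1 hG
  filter_upwards [h1.prod_right_ae, hG.1.prodMk_left] with x hx hx2
  exact (memLp_two_iff_integrable_sq_norm hx2).2 hx

/-- Pairing the second variable of a square integrable function with an `L²` function gives an
`L²` function of the first variable, by the Cauchy–Schwarz inequality. -/
theorem memLp_integral_conj_mul {X Y : Type*} [MeasurableSpace X] [MeasurableSpace Y]
    {μ : Measure X} {ν : Measure Y} [SFinite μ] [SFinite ν] {G : X × Y → ℂ}
    (hG : MemLp G 2 (μ.prod ν)) {g : Y → ℂ} (hg : MemLp g 2 ν) :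
    MemLp (fun x => ∫ y, starRingEnd ℂ (g y) * G (x, y) ∂ν) 2 μ := by
  have hmeas : AEStronglyMeasurable (fun x => ∫ y, starRingEnd ℂ (g y) * G (x, y) ∂ν) μ :=
    AEStronglyMeasurable.integral_prod_right' (f := fun z => starRingEnd ℂ (g z.2) * G z)
      (hg.star.1.comp_snd.mul hG.1)
  refine (memLp_two_iff_integrable_sq_norm hmeas).2 ?_
  have h1 := ((memLp_two_iff_integrable_sq_norm hG.1).1 hG).integral_prod_left
  refine (h1.const_mul (‖hg.toLp‖ ^ 2)).mono' (hmeas.norm.pow 2) ?_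
  filter_upwards [memLp_prod_slice hG] with x hx
  have h2 : ∫ y, starRingEnd ℂ (g y) * G (x, y) ∂ν = inner ℂ hg.toLp hx.toLp := by
    rw [L2.inner_def]
    refine integral_congr_ae ?_
    filter_upwards [hg.coeFn_toLp, hx.coeFn_toLp] with y e1 e2
    rw [e1, e2, RCLike.inner_apply, mul_comm]
  have h3 : ‖hx.toLp‖ ^ 2 = ∫ y, ‖G (x, y)‖ ^ 2 ∂ν := by
    have : (inner ℂ hx.toLp hx.toLp : ℂ) = ∫ y, ((‖G (x, y)‖ ^ 2 : ℝ) : ℂ) ∂ν := by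
      rw [L2.inner_def]
      refine integral_congr_ae ?_
      filter_upwards [hx.coeFn_toLp] with y e1
      rw [e1, inner_self_eq_norm_sq_to_K]
      push_cast
      rfl
    rw [inner_self_eq_norm_sq_to_K, integral_complex_ofReal] at this
    exact Complex.ofReal_injective ((Complex.ofReal_pow _ _).trans this)
  rw [Real.norm_of_nonneg (sq_nonneg _), h2, ← h3, ← mul_pow]
  exact pow_le_pow_left₀ (norm_nonneg _) (norm_inner_le_norm _ _) 2

theorem measurePreserving_cons (n : ℕ) : MeasurePreserving
    (fun P : (Fin n → Mode) × Mode => (Fin.cons P.2 P.1 : Fin (n + 1) → Mode))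
    ((confMeasure n).prod modeMeasure) (confMeasure (n + 1)) := by
  have h := (measurePreserving_piFinSuccAbove (fun _ : Fin (n + 1) => modeMeasure) 0).symm.comp
    (Measure.measurePreserving_swap (μ := confMeasure n) (ν := modeMeasure))
  convert h using 1
  funext P
  simp [MeasurableEquiv.piFinSuccAbove, Fin.consEquiv]

theorem memLp_cons {n : ℕ} {F : (Fin (n + 1) → Mode) → ℂ} (hF : MemLp F 2 (confMeasure (n + 1))) :
    MemLp (fun P : (Fin n → Mode) × Mode => F (Fin.cons P.2 P.1)) 2
      ((confMeasure n).prod modeMeasure) :=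
  hF.comp_measurePreserving (measurePreserving_cons n)

theorem memLp_slice {n : ℕ} {F : (Fin (n + 1) → Mode) → ℂ}
    (hF : MemLp F 2 (confMeasure (n + 1))) :
    ∀ᵐ x ∂(confMeasure n), MemLp (fun y => F (Fin.cons y x)) 2 modeMeasure :=
  memLp_prod_slice (memLp_cons hF)

theorem memLp_comp (Ψ : Fock) (n : ℕ) : MemLp (comp Ψ n) 2 (confMeasure n) := Lp.memLp _

end Slices

/-! ### The domain of the annihilation operator -/

section Density

theorem cons_comp_decomposeFin {n : ℕ} (y : Mode) (x : Fin n → Mode) (σ : Equiv.Perm (Fin n)) :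
    (Fin.cons y x : Fin (n + 1) → Mode) ∘ Equiv.Perm.decomposeFin.symm (0, σ)
      = Fin.cons y (x ∘ σ) := by
  funext i
  refine Fin.cases ?_ (fun j => ?_) i
  · simp
  · simp

theorem comp_single_self {n : ℕ} (ψ : NPhoton n) :
    comp (lp.single 2 n ψ) n = ((ψ : Lp ℂ 2 (confMeasure n)) : (Fin n → Mode) → ℂ) := by
  rw [comp, lp.single_apply_self]

theorem comp_single_ne {n k : ℕ} (ψ : NPhoton n) (h : k ≠ n) :
    comp (lp.single 2 n ψ) k =ᵐ[confMeasure k] fun _ => 0 := by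
  rw [comp, lp.single_apply_ne _ _ _ h]
  exact Lp.coeFn_zero _ _ _

variable {f : Mode → ℂ}

/-- The image of an `n + 1`-photon function under annihilation lies in the `n`-photon space. -/
theorem exists_annihilate (hf : MemLp f 2 modeMeasure) {n : ℕ} (ψ : NPhoton (n + 1)) :
    ∃ φ : NPhoton n, ((φ : Lp ℂ 2 (confMeasure n)) : (Fin n → Mode) → ℂ) =ᵐ[confMeasure n]
      fun x => (Real.sqrt (n + 1) : ℂ) * ∫ y, starRingEnd ℂ (f y) *
        (ψ : Lp ℂ 2 (confMeasure (n + 1))) (Fin.cons y x) ∂modeMeasure := by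
  set F : (Fin (n + 1) → Mode) → ℂ := ((ψ : Lp ℂ 2 (confMeasure (n + 1))) : _ → ℂ) with hF
  have hmem : MemLp (fun x => (Real.sqrt (n + 1) : ℂ) * ∫ y, starRingEnd ℂ (f y) *
      F (Fin.cons y x) ∂modeMeasure) 2 (confMeasure n) :=
    (memLp_integral_conj_mul (memLp_cons (Lp.memLp _)) hf).const_mul _
  refine ⟨⟨hmem.toLp, mem_NPhoton_iff.2 fun σ => ?_⟩, hmem.coeFn_toLp⟩
  have hsym := mem_NPhoton_iff.1 ψ.2 (Equiv.Perm.decomposeFin.symm (0, σ))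
  filter_upwards [hmem.coeFn_toLp,
    (measurePreserving_perm σ).quasiMeasurePreserving.ae hmem.coeFn_toLp, ae_slice hsym]
    with x h1 h2 h3
  rw [h1, h2]
  congr 1
  refine integral_congr_ae ?_
  filter_upwards [h3] with y hy
  rw [cons_comp_decomposeFin] at hy
  rw [hF, hy]

theorem single_mem_annihilation_domain (hf : MemLp f 2 modeMeasure) {n : ℕ} (ψ : NPhoton n) :
    lp.single 2 n ψ ∈ (annihilation f).domain := by
  -- an `n`-photon vector is annihilated unless `n = k + 1`, when its image has `k` photons
  have hzero : ∀ k, k + 1 ≠ n → ∀ᵐ x ∂(confMeasure k), (fun y => starRingEnd ℂ (f y) *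
      comp (lp.single 2 n ψ) (k + 1) (Fin.cons y x)) =ᵐ[modeMeasure] fun _ => 0 := by
    intro k hk
    filter_upwards [ae_slice (comp_single_ne ψ hk)] with x hx
    filter_upwards [hx] with y hy
    rw [hy, mul_zero]
  suffices h : ∃ Φ : Fock, (lp.single 2 n ψ, Φ) ∈ annihilationGraph f by
    obtain ⟨Φ, hΦ⟩ := h
    rw [← annihilation_graph] at hΦ
    exact LinearPMap.mem_domain_of_mem_graph hΦ
  cases n with
  | zero =>
    refine ⟨0, fun k => ?_⟩
    filter_upwards [hzero k (Nat.succ_ne_zero k), comp_zero k] with x hx hx2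
    refine ⟨(integrable_congr hx).2 (integrable_zero _ _ _), ?_⟩
    rw [hx2, integral_congr_ae hx]
    simp
  | succ n =>
    obtain ⟨φ, hφ⟩ := exists_annihilate hf ψ
    refine ⟨lp.single 2 n φ, fun k => ?_⟩
    by_cases hk : k = n
    · subst hk
      simp only [comp_single_self]
      filter_upwards [hφ, memLp_slice (Lp.memLp (ψ : Lp ℂ 2 (confMeasure (k + 1))))] with x h1 h2
      exact ⟨integrable_conj_mul hf h2, h1⟩
    · filter_upwards [hzero k (by simpa using hk), comp_single_ne φ hk] with x hx hx2
      refine ⟨(integrable_congr hx).2 (integrable_zero _ _ _), ?_⟩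
      rw [hx2, integral_congr_ae hx]
      simp

/-- For square integrable `f` the operator `a(f)` is densely defined: its domain contains all
vectors with finitely many photons. -/
theorem dense_annihilation_domain (hf : MemLp f 2 modeMeasure) :
    Dense ((annihilation f).domain : Set Fock) := by
  intro Ψ
  refine mem_closure_of_tendsto (lp.hasSum_single (by norm_num) Ψ)
    (Filter.Eventually.of_forall fun s => ?_)
  exact Submodule.sum_mem _ fun n _ => single_mem_annihilation_domain hf _

end Density

/-! ### Symmetry of the field operators -/

section Symmetry

theorem dGamma_isFormalAdjoint (φ : Mode → ℝ) : (dGamma φ).IsFormalAdjoint (dGamma φ) := by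
  rw [isFormalAdjoint_iff_graph, dGamma_graph]
  intro P hP Q hQ
  rw [lp.inner_eq_tsum, lp.inner_eq_tsum]
  refine tsum_congr fun n => ?_
  change inner ℂ ((P.2 n : NPhoton n) : Lp ℂ 2 (confMeasure n)) (Q.1 n : NPhoton n) =
    inner ℂ ((P.1 n : NPhoton n) : Lp ℂ 2 (confMeasure n)) (Q.2 n : NPhoton n)
  rw [L2.inner_def, L2.inner_def]
  refine integral_congr_ae ?_
  filter_upwards [hP n, hQ n] with x h1 h2
  change inner ℂ (comp P.2 n x) (comp Q.1 n x) = inner ℂ (comp P.1 n x) (comp Q.2 n x)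
  rw [h1, h2, RCLike.inner_apply, RCLike.inner_apply, map_mul, Complex.conj_ofReal]
  ring

variable {E : Type*} [NormedAddCommGroup E] [InnerProductSpace ℂ E]

theorem IsFormalAdjoint.add {S T : E →ₗ.[ℂ] E} (hS : S.IsFormalAdjoint S)
    (hT : T.IsFormalAdjoint T) : (S + T).IsFormalAdjoint (S + T) := fun x y => by
  rw [LinearPMap.add_apply, LinearPMap.add_apply, inner_add_left, inner_add_right]
  exact congrArg₂ _ (hS ⟨x, x.2.1⟩ ⟨y, y.2.1⟩) (hT ⟨x, x.2.2⟩ ⟨y, y.2.2⟩)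

theorem IsFormalAdjoint.sub {S T : E →ₗ.[ℂ] E} (hS : S.IsFormalAdjoint S)
    (hT : T.IsFormalAdjoint T) : (S - T).IsFormalAdjoint (S - T) := fun x y => by
  rw [LinearPMap.sub_apply, LinearPMap.sub_apply, inner_sub_left, inner_sub_right]
  exact congrArg₂ _ (hS ⟨x, x.2.1⟩ ⟨y, y.2.1⟩) (hT ⟨x, x.2.2⟩ ⟨y, y.2.2⟩)

theorem IsFormalAdjoint.real_smul {T : E →ₗ.[ℂ] E} (hT : T.IsFormalAdjoint T) (c : ℝ) :
    ((c : ℂ) • T).IsFormalAdjoint ((c : ℂ) • T) := fun x y => by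
  rw [LinearPMap.smul_apply, LinearPMap.smul_apply, inner_smul_left, inner_smul_right,
    Complex.conj_ofReal]
  exact congrArg _ (hT x y)

theorem isFormalAdjoint_add_adjoint [CompleteSpace E] {T : E →ₗ.[ℂ] E}
    (hT : Dense (T.domain : Set E)) :
    (T + T.adjoint).IsFormalAdjoint (T + T.adjoint) := fun x y => by
  have h1 := LinearPMap.adjoint_isFormalAdjoint hT ⟨x, x.2.2⟩ ⟨y, y.2.1⟩
  have h2 := (LinearPMap.adjoint_isFormalAdjoint hT).symm ⟨x, x.2.1⟩ ⟨y, y.2.2⟩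
  rw [LinearPMap.add_apply, LinearPMap.add_apply, inner_add_left, inner_add_right, add_comm]
  exact congrArg₂ _ h1 h2

theorem vectorPotential_isFormalAdjoint {ρ : Momentum → ℂ} {e : Fin 2 → Momentum → Momentum}
    {j : Fin 3} (hg : MemLp (formFactor ρ e j) 2 modeMeasure) :
    (vectorPotential ρ e j).IsFormalAdjoint (vectorPotential ρ e j) :=
  IsFormalAdjoint.real_smul (isFormalAdjoint_closure
    (isFormalAdjoint_add_adjoint (dense_annihilation_domain hg))) _

end Symmetry

/-! ### Intertwining relations -/

section Intertwining

variable {E : Type*} [NormedAddCommGroup E] [InnerProductSpace ℂ E]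

/-- `A U = ε U A` on the domain of `A`, which `U` maps into itself. -/
def Intertwines (U : E →ₗᵢ[ℂ] E) (ε : ℂ) (A : E →ₗ.[ℂ] E) : Prop :=
  ∀ x : A.domain, ∃ h : U x ∈ A.domain, A ⟨U x, h⟩ = ε • U (A x)

theorem intertwines_iff_graph {U : E →ₗᵢ[ℂ] E} {ε : ℂ} {A : E →ₗ.[ℂ] E} :
    Intertwines U ε A ↔ ∀ P ∈ A.graph, (U P.1, ε • U P.2) ∈ A.graph := by
  constructor
  · intro h P hP
    obtain ⟨x, hx, hx2⟩ := (LinearPMap.mem_graph_iff _).1 hP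
    obtain ⟨h1, h2⟩ := h x
    rw [← hx, ← hx2, ← h2]
    exact A.mem_graph ⟨U x, h1⟩
  · intro h x
    obtain ⟨y, hy, hy2⟩ := (LinearPMap.mem_graph_iff _).1 (h _ (A.mem_graph x))
    simp only at hy hy2
    refine ⟨hy ▸ y.2, ?_⟩
    rw [← hy2]
    congr 1
    exact Subtype.ext hy.symm

variable {U : E →ₗᵢ[ℂ] E} {ε : ℂ} {A B : E →ₗ.[ℂ] E}

theorem Intertwines.add (hA : Intertwines U ε A) (hB : Intertwines U ε B) :
    Intertwines U ε (A + B) := fun x => by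
  obtain ⟨h1, e1⟩ := hA ⟨x, x.2.1⟩
  obtain ⟨h2, e2⟩ := hB ⟨x, x.2.2⟩
  refine ⟨⟨h1, h2⟩, ?_⟩
  rw [LinearPMap.add_apply, LinearPMap.add_apply, map_add, smul_add]
  exact congrArg₂ _ e1 e2

theorem Intertwines.sub (hA : Intertwines U ε A) (hB : Intertwines U ε B) :
    Intertwines U ε (A - B) := fun x => by
  obtain ⟨h1, e1⟩ := hA ⟨x, x.2.1⟩
  obtain ⟨h2, e2⟩ := hB ⟨x, x.2.2⟩
  refine ⟨⟨h1, h2⟩, ?_⟩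
  rw [LinearPMap.sub_apply, LinearPMap.sub_apply, map_sub, smul_sub]
  exact congrArg₂ _ e1 e2

theorem Intertwines.smul (hA : Intertwines U ε A) (c : ℂ) : Intertwines U ε (c • A) := fun x => by
  obtain ⟨h1, e1⟩ := hA x
  refine ⟨h1, ?_⟩
  rw [LinearPMap.smul_apply, LinearPMap.smul_apply, map_smul, smul_comm ε]
  exact congrArg _ e1

theorem Intertwines.closure (hA : Intertwines U ε A) : Intertwines U ε A.closure := by
  rw [intertwines_iff_graph] at hA ⊢
  by_cases hc : A.IsClosable
  · rw [← hc.graph_closure_eq_closure_graph]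
    intro P hP
    have hcont : Continuous fun P : E × E => (U P.1, ε • U P.2) := by fun_prop
    exact map_mem_closure (f := fun P : E × E => (U P.1, ε • U P.2)) hcont hP hA
  · rwa [LinearPMap.closure_def' hc]

/-- The relation `A U = ε U A` with a self-adjoint unitary `U` and `|ε| = 1` passes to `A*`. -/
theorem Intertwines.adjoint [CompleteSpace E] (hA : Intertwines U ε A)
    (hd : Dense (A.domain : Set E)) (hε : starRingEnd ℂ ε * ε = 1)
    (hU : ∀ x y, (inner ℂ (U x) y : ℂ) = inner ℂ x (U y)) : Intertwines U ε A.adjoint := by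
  intro x
  have key : ∀ z : A.domain, (inner ℂ (ε • U (A.adjoint x)) (z : E) : ℂ) = inner ℂ (U x) (A z) := by
    intro z
    obtain ⟨h, hz⟩ := hA z
    have h1 := LinearPMap.adjoint_isFormalAdjoint hd x ⟨U z, h⟩
    rw [inner_smul_left, hU, h1, hz, inner_smul_right, ← mul_assoc, hε, one_mul, hU]
  exact ⟨A.mem_adjoint_domain_of_exists _ ⟨_, key⟩, LinearPMap.adjoint_apply_eq hd _ key⟩

end Intertwining

/-! ### Parity and the field operators -/

section ParityOnFock

variable {v : Fin 2 → Mode → ℂ}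

theorem IsParity.intertwines_dGamma (hv : IsParity v) {φ : Mode → ℝ} {ε : ℝ} (hε : ε * ε = 1)
    (hφ : ∀ s x, φ (modeFlip s x) = ε * φ x) : Intertwines hv.onFock ε (dGamma φ) := by
  rw [intertwines_iff_graph, dGamma_graph]
  intro P hP n
  filter_upwards [hv.comp_onFock P.1 n, hv.comp_onFock P.2 n, comp_smul ε (hv.onFock P.2) n,
    (hv.isReflection n).ae (hP n)] with x h1 h2 h3 h4
  rw [h3, h1, h2]
  simp only [weightedComp, h4, Finset.mul_sum]
  refine Finset.sum_congr rfl fun s _ => ?_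
  have h5 : ∑ i, φ (confFlip s x i) = ε * ∑ i, φ (x i) := by
    rw [Finset.mul_sum]
    exact Finset.sum_congr rfl fun i _ => hφ _ _
  have h6 : (ε : ℂ) * ε = 1 := by exact_mod_cast hε
  rw [h5, Complex.ofReal_mul]
  linear_combination (confCoeff v s x * ((∑ i, φ (x i) : ℝ) : ℂ) * comp P.1 n (confFlip s x)) * h6

/-- Splitting off the first photon variable. -/
theorem weightedComp_cons {n : ℕ} (F : (Fin (n + 1) → Mode) → ℂ) (y : Mode) (x : Fin n → Mode) :
    weightedComp (confCoeff v) confFlip F (Fin.cons y x) = ∑ s : Fin n → Fin 2,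
      confCoeff v s x * weightedComp v modeFlip (fun z => F (Fin.cons z (confFlip s x))) y := by
  simp only [weightedComp, Finset.mul_sum]
  rw [Finset.sum_comm, ← Fintype.sum_prod_type']
  refine (Fintype.sum_equiv (Fin.consEquiv fun _ : Fin (n + 1) => Fin 2) _ _ fun P => ?_).symm
  have h1 : confCoeff v (Fin.consEquiv (fun _ : Fin (n + 1) => Fin 2) P) (Fin.cons y x)
      = v P.1 y * confCoeff v P.2 x := by
    simp [confCoeff, Fin.prod_univ_succ, Fin.consEquiv]
  have h2 : confFlip (Fin.consEquiv (fun _ : Fin (n + 1) => Fin 2) P) (Fin.cons y x)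
      = Fin.cons (modeFlip P.1 y) (confFlip P.2 x) := by
    funext i
    refine Fin.cases ?_ (fun j => ?_) i <;> simp [confFlip, Fin.consEquiv]
  rw [h1, h2]
  ring

/-- If the one-photon parity maps `g` to `-g`, then its second quantization anticommutes
with `a(g)`. -/
theorem IsParity.intertwines_annihilation (hv : IsParity v) {g : Mode → ℂ}
    (hg : MemLp g 2 modeMeasure)
    (hvg : weightedComp v modeFlip g =ᵐ[modeMeasure] fun y => -g y) :
    Intertwines hv.onFock (-1) (annihilation g) := by
  rw [intertwines_iff_graph, annihilation_graph]
  intro P hP n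
  have hslice := (hv.isReflection n).ae (memLp_slice (memLp_comp P.1 (n + 1)))
  filter_upwards [ae_slice (hv.comp_onFock P.1 (n + 1)), hv.comp_onFock P.2 n,
    comp_smul (-1) (hv.onFock P.2) n, (hv.isReflection n).ae (hP n), hslice,
    memLp_slice (memLp_comp (hv.onFock P.1) (n + 1))] with x h1 h2 h3 h4 h5 h6
  refine ⟨integrable_conj_mul hg h6, ?_⟩
  have e1 : ∫ y, starRingEnd ℂ (g y) * comp (hv.onFock P.1) (n + 1) (Fin.cons y x) ∂modeMeasure
      = ∫ y, ∑ s : Fin n → Fin 2, confCoeff v s x * (starRingEnd ℂ (g y) *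
        weightedComp v modeFlip (fun z => comp P.1 (n + 1) (Fin.cons z (confFlip s x))) y)
          ∂modeMeasure := by
    refine integral_congr_ae ?_
    filter_upwards [h1] with y hy
    rw [hy, weightedComp_cons, Finset.mul_sum]
    exact Finset.sum_congr rfl fun s _ => by ring
  have e2 : ∀ s : Fin n → Fin 2, ∫ y, starRingEnd ℂ (g y) * weightedComp v modeFlip
      (fun z => comp P.1 (n + 1) (Fin.cons z (confFlip s x))) y ∂modeMeasure
      = -∫ y, starRingEnd ℂ (g y) * comp P.1 (n + 1) (Fin.cons y (confFlip s x)) ∂modeMeasure := by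
    intro s
    rw [hv.isReflection_mode.symm hg (h5 s), ← integral_neg]
    refine integral_congr_ae ?_
    filter_upwards [hvg] with y hy
    rw [hy, map_neg, neg_mul]
  rw [h3, h2, e1, integral_finsetSum _ fun s _ =>
    (integrable_conj_mul hg (hv.isReflection_mode.memLp (h5 s))).const_mul _]
  simp only [integral_const_mul, e2]
  simp only [weightedComp, Finset.mul_sum]
  refine Finset.sum_congr rfl fun s _ => ?_
  rw [(h4 s).2]
  ring

theorem IsParity.intertwines_vectorPotential (hv : IsParity v) {ρ : Momentum → ℂ}
    {e : Fin 2 → Momentum → Momentum} {j : Fin 3}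
    (hg : MemLp (formFactor ρ e j) 2 modeMeasure)
    (hvg : weightedComp v modeFlip (formFactor ρ e j) =ᵐ[modeMeasure]
      fun y => -formFactor ρ e j y) :
    Intertwines hv.onFock (-1) (vectorPotential ρ e j) := by
  have ha := hv.intertwines_annihilation hg hvg
  exact ((ha.add (ha.adjoint (dense_annihilation_domain hg) (by simp)
    hv.inner_onFock)).closure).smul _

end ParityOnFock

/-! ### The one-photon parity -/

section OnePhoton

/-- The two polarization vectors at `-k` span the plane orthogonal to `k`. -/
theorem IsPolarization.sum_inner_smul {e : Fin 2 → Momentum → Momentum} (he : IsPolarization e)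
    (l : Fin 2) (k : Momentum) : ∑ n, inner ℝ (e l k) (e n (-k)) • e n (-k) = e l k := by
  have ho : Orthonormal ℝ fun n => e n (-k) := he.orthonormal (-k)
  suffices h : e l k ∈ Submodule.span ℝ (Set.range fun n => e n (-k)) by
    obtain ⟨c, hc⟩ := (Submodule.mem_span_range_iff_exists_fun ℝ).1 h
    conv_rhs => rw [← hc]
    refine Finset.sum_congr rfl fun n _ => ?_
    rw [← hc, real_inner_comm, ho.inner_right_fintype]
  by_cases hk : k = 0
  · exact Submodule.subset_span ⟨l, by simp [hk]⟩
  · have : Fact (Module.finrank ℝ Momentum = 2 + 1) := ⟨by simp⟩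
    have hle : Submodule.span ℝ (Set.range fun n => e n (-k)) ≤ (Submodule.span ℝ {k})ᗮ := by
      rw [Submodule.span_le]
      rintro _ ⟨n, rfl⟩
      have h := he.transversal n (-k)
      rw [inner_neg_right, neg_eq_zero] at h
      exact Submodule.mem_orthogonal_singleton_iff_inner_left.2 h
    have heq := Submodule.eq_of_le_of_finrank_eq hle (by
      rw [finrank_span_eq_card ho.linearIndependent, Fintype.card_fin,
        Submodule.finrank_orthogonal_span_singleton (n := 2) hk])
    rw [heq]
    exact Submodule.mem_orthogonal_singleton_iff_inner_left.2 (he.transversal l k)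

/-- The phase `r(k) / r(-k)`, replaced by `1` where `r` vanishes or `|r(k)| ≠ |r(-k)|`. -/
def phase (r : Momentum → ℂ) (k : Momentum) : ℂ :=
  if ‖r k‖ = ‖r (-k)‖ ∧ r k ≠ 0 then r k / r (-k) else 1

theorem measurable_phase {r : Momentum → ℂ} (hr : Measurable r) : Measurable (phase r) := by
  have hr' : Measurable fun k => r (-k) := hr.comp measurable_neg
  refine Measurable.ite ?_ (hr.div hr') measurable_const
  exact (measurableSet_eq_fun hr.norm hr'.norm).inter (hr (measurableSet_singleton 0).compl)

/-- `θ(k)` has modulus one and `θ(-k)` is its inverse, for every `k`. -/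
theorem phase_neg (r : Momentum → ℂ) (k : Momentum) :
    starRingEnd ℂ (phase r (-k)) = phase r k ∧ phase r k * phase r (-k) = 1 := by
  unfold phase
  rw [neg_neg]
  by_cases h : ‖r k‖ = ‖r (-k)‖ ∧ r k ≠ 0
  · have h0 : r (-k) ≠ 0 := by rw [← norm_ne_zero_iff, ← h.1, norm_ne_zero_iff]; exact h.2
    rw [if_pos h, if_pos ⟨h.1.symm, h0⟩]
    constructor
    · have h1 : starRingEnd ℂ (r k) ≠ 0 := by simpa using h.2
      rw [map_div₀, div_eq_div_iff h1 h0, mul_comm _ (r (-k)), Complex.mul_conj, Complex.mul_conj,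
        Complex.normSq_eq_norm_sq, Complex.normSq_eq_norm_sq, h.1]
    · have := h.2
      field_simp
  · have h' : ¬ (‖r (-k)‖ = ‖r k‖ ∧ r (-k) ≠ 0) := fun h' => h ⟨h'.1.symm, by
      rw [← norm_ne_zero_iff, ← h'.1, norm_ne_zero_iff]; exact h'.2⟩
    rw [if_neg h, if_neg h']
    simp

theorem phase_mul {r : Momentum → ℂ} {k : Momentum} (h : ‖r k‖ = ‖r (-k)‖) :
    phase r k * r (-k) = r k := by
  unfold phase
  by_cases h0 : r k = 0
  · have h1 : r (-k) = 0 := by rw [← norm_eq_zero, ← h, h0, norm_zero]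
    rw [h0, h1, mul_zero]
  · have h1 : r (-k) ≠ 0 := by rw [← norm_ne_zero_iff, ← h, norm_ne_zero_iff]; exact h0
    rw [if_pos ⟨h, h0⟩, div_mul_cancel₀ _ h1]

/-- The coefficients of the one-photon parity
`(u f)(k, l) = -θ(k) ∑ₙ ⟨e l k, e n (-k)⟩ f(-k, n)` with the phase `θ(k) = r(k) / r(-k)`. -/
def parityCoeff (r : Momentum → ℂ) (e : Fin 2 → Momentum → Momentum) (s : Fin 2) (x : Mode) : ℂ :=
  -(phase r x.1 * (inner ℝ (e x.2 x.1) (e (x.2 + s) (-x.1)) : ℝ))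

theorem isParity_parityCoeff {r : Momentum → ℂ} (hr : Measurable r)
    {e : Fin 2 → Momentum → Momentum} (he : IsPolarization e) : IsParity (parityCoeff r e) where
  measurable s := by
    refine (((measurable_phase hr).comp measurable_fst).mul
      (Complex.measurable_ofReal.comp ?_)).neg
    refine measurable_from_prod_countable_left fun l => ?_
    exact (he.measurable l).inner ((he.measurable (l + s)).comp measurable_neg)
  hermitian s x := by
    simp only [parityCoeff, modeFlip, neg_neg, Fin2.add_self, map_neg, map_mul, Complex.conj_ofReal,
      (phase_neg r x.1).1]
    rw [real_inner_comm]
  sum_mul t x := by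
    have h1 : ∀ s, parityCoeff r e s x * parityCoeff r e (s + t) (modeFlip s x)
        = ((inner ℝ (e x.2 x.1) (e (x.2 + s) (-x.1)) *
          inner ℝ (e (x.2 + s) (-x.1)) (e (x.2 + t) x.1) : ℝ) : ℂ) := fun s => by
      simp only [parityCoeff, modeFlip, neg_neg, Fin2.add_add]
      push_cast
      linear_combination ((inner ℝ (e x.2 x.1) (e (x.2 + s) (-x.1)) : ℝ) : ℂ) *
        ((inner ℝ (e (x.2 + s) (-x.1)) (e (x.2 + t) x.1) : ℝ) : ℂ) * (phase_neg r x.1).2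
    have h2 : ∑ s, inner ℝ (e x.2 x.1) (e (x.2 + s) (-x.1)) *
        inner ℝ (e (x.2 + s) (-x.1)) (e (x.2 + t) x.1)
          = inner ℝ (e x.2 x.1) (e (x.2 + t) x.1) := by
      conv_rhs => rw [← he.sum_inner_smul x.2 x.1, sum_inner]
      refine Fintype.sum_equiv (Equiv.addLeft x.2) _ _ fun s => ?_
      rw [inner_smul_left]
      rfl
    simp only [h1]
    rw [← Complex.ofReal_sum, h2, orthonormal_iff_ite.1 (he.orthonormal x.1)]
    by_cases ht : t = 0
    · simp [ht]
    · simp [ht]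

/-- The one-photon parity maps each form factor `g_j` to `-g_j`. This is where
`|ρ(k)| = |ρ(-k)|` enters. -/
theorem weightedComp_parityCoeff_formFactor {ρ r : Momentum → ℂ} {e : Fin 2 → Momentum → Momentum}
    (he : IsPolarization e) (hr : ρ =ᵐ[volume] r) (hsymm : ∀ᵐ k : Momentum, ‖ρ k‖ = ‖ρ (-k)‖)
    (j : Fin 3) : weightedComp (parityCoeff r e) modeFlip (formFactor ρ e j)
      =ᵐ[modeMeasure] fun y => -formFactor ρ e j y := by
  have hr2 : ∀ᵐ k : Momentum, ρ (-k) = r (-k) :=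
    (Measure.measurePreserving_neg (volume : Measure Momentum)).quasiMeasurePreserving.ae hr
  have h : ∀ᵐ k : Momentum, phase r k * ρ (-k) = ρ k := by
    filter_upwards [hr, hr2, hsymm] with k h1 h2 h3
    rw [h1, h2, phase_mul]
    rwa [← h1, ← h2]
  filter_upwards [Measure.quasiMeasurePreserving_fst.ae h] with y hy
  have h2 : ∑ s, inner ℝ (e y.2 y.1) (e (y.2 + s) (-y.1)) * e (y.2 + s) (-y.1) j
      = e y.2 y.1 j := by
    conv_rhs => rw [← he.sum_inner_smul y.2 y.1, WithLp.ofLp_sum, Finset.sum_apply]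
    exact Fintype.sum_equiv (Equiv.addLeft y.2) _ _ fun s => rfl
  have h3 : ∑ s, ((inner ℝ (e y.2 y.1) (e (y.2 + s) (-y.1)) : ℝ) : ℂ) *
      ((e (y.2 + s) (-y.1) j : ℝ) : ℂ) = ((e y.2 y.1 j : ℝ) : ℂ) := by
    exact_mod_cast congrArg (fun t : ℝ => (t : ℂ)) h2
  simp only [weightedComp, parityCoeff, formFactor, modeFlip, norm_neg]
  rw [← h3, Finset.mul_sum, ← Finset.sum_neg_distrib]
  refine Finset.sum_congr rfl fun s _ => ?_
  linear_combination (-((‖y.1‖ ^ (-(1 / 2) : ℝ) : ℝ) : ℂ) *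
    ((inner ℝ (e y.2 y.1) (e (y.2 + s) (-y.1)) : ℝ) : ℂ) *
      ((e (y.2 + s) (-y.1) j : ℝ) : ℂ)) * hy

/-- The form factor is square integrable, since `|k|^{-1/2} ≤ 1 + |k|⁻¹` (also at `k = 0`, where
both powers are `0` by convention). -/
theorem memLp_formFactor {ρ : Momentum → ℂ} {e : Fin 2 → Momentum → Momentum}
    (he : IsPolarization e) (hρ : MemLp ρ 2 volume)
    (hρω : MemLp (fun k => ((‖k‖⁻¹ : ℝ) : ℂ) * ρ k) 2 volume) (j : Fin 3) :
    MemLp (formFactor ρ e j) 2 modeMeasure := by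
  have h1 : MemLp (fun k => ‖ρ k‖ + ‖((‖k‖⁻¹ : ℝ) : ℂ) * ρ k‖) 2 volume := hρ.norm.add hρω.norm
  refine (h1.comp_fst (Measure.count : Measure (Fin 2))).mono' ?_
    (Filter.Eventually.of_forall fun x => ?_)
  · have hm : Measurable fun x : Mode => ((e x.2 x.1 j : ℝ) : ℂ) :=
      Complex.measurable_ofReal.comp <| measurable_from_prod_countable_left fun l =>
        (measurable_pi_apply j).comp ((WithLp.measurable_ofLp 2 _).comp (he.measurable l))
    have hn : Measurable fun x : Mode => ((‖x.1‖ ^ (-(1 / 2) : ℝ) : ℝ) : ℂ) := by fun_prop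
    exact (hn.aestronglyMeasurable.mul hρ.1.comp_fst).mul hm.aestronglyMeasurable
  · have he1 : ‖e x.2 x.1 j‖ ≤ 1 :=
      (PiLp.norm_apply_le (e x.2 x.1) j).trans ((he.orthonormal x.1).1 x.2).le
    have hk : ‖x.1‖ ^ (-(1 / 2) : ℝ) ≤ 1 + ‖x.1‖⁻¹ := by
      rcases (norm_nonneg x.1).eq_or_lt with h0 | h0
      · rw [← h0, Real.zero_rpow (by norm_num)]
        norm_num
      · rcases le_total 1 ‖x.1‖ with h | h
        · exact (Real.rpow_le_one_of_one_le_of_nonpos h (by norm_num)).trans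
            (le_add_of_nonneg_right (inv_nonneg.2 h0.le))
        · rw [← Real.rpow_neg_one]
          exact (Real.rpow_le_rpow_of_exponent_ge h0 h (by norm_num)).trans
            (le_add_of_nonneg_left zero_le_one)
    simp only [formFactor, norm_mul, Complex.norm_real]
    rw [Real.norm_of_nonneg (Real.rpow_nonneg (norm_nonneg _) _),
      Real.norm_of_nonneg (inv_nonneg.2 (norm_nonneg _))]
    calc ‖x.1‖ ^ (-(1 / 2) : ℝ) * ‖ρ x.1‖ * ‖e x.2 x.1 j‖
        ≤ ‖x.1‖ ^ (-(1 / 2) : ℝ) * ‖ρ x.1‖ := mul_le_of_le_one_right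
          (mul_nonneg (Real.rpow_nonneg (norm_nonneg _) _) (norm_nonneg _)) he1
      _ ≤ (1 + ‖x.1‖⁻¹) * ‖ρ x.1‖ := mul_le_mul_of_nonneg_right hk (norm_nonneg _)
      _ = ‖ρ x.1‖ + ‖x.1‖⁻¹ * ‖ρ x.1‖ := by ring

end OnePhoton

/-! ### Operators on spinors -/

section Spinor

theorem spin_apply (S : Matrix (Fin 4) (Fin 4) ℂ) (Ψ : SpinorFock) (a : Fin 4) :
    spin S Ψ a = ∑ b, S a b • Ψ b := rfl

theorem spin_spin (S T : Matrix (Fin 4) (Fin 4) ℂ) (Ψ : SpinorFock) :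
    spin S (spin T Ψ) = spin (S * T) Ψ := by
  ext1 a
  simp only [spin_apply, Finset.smul_sum, Matrix.mul_apply, Finset.sum_smul, smul_smul]
  exact Finset.sum_comm

theorem spin_one (Ψ : SpinorFock) : spin 1 Ψ = Ψ := by
  ext1 a
  simp [spin_apply, Matrix.one_apply]

theorem spin_neg (S : Matrix (Fin 4) (Fin 4) ℂ) (Ψ : SpinorFock) : spin (-S) Ψ = -spin S Ψ := by
  ext1 a
  simp [spin_apply]

theorem spin_add (S T : Matrix (Fin 4) (Fin 4) ℂ) (Ψ : SpinorFock) :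
    spin (S + T) Ψ = spin S Ψ + spin T Ψ := by
  ext1 a
  simp [spin_apply, add_smul, Finset.sum_add_distrib]

theorem inner_spin {S : Matrix (Fin 4) (Fin 4) ℂ} (hS : S.IsHermitian) (Ψ Φ : SpinorFock) :
    (inner ℂ (spin S Ψ) Φ : ℂ) = inner ℂ Ψ (spin S Φ) := by
  simp only [PiLp.inner_apply, spin_apply, sum_inner, inner_sum, inner_smul_left, inner_smul_right]
  rw [Finset.sum_comm]
  refine Finset.sum_congr rfl fun a _ => Finset.sum_congr rfl fun b _ => ?_
  rw [starRingEnd_apply, hS.apply]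

/-- `S ⊗ 1` as a bounded operator. -/
def spinL (S : Matrix (Fin 4) (Fin 4) ℂ) : SpinorFock →L[ℂ] SpinorFock where
  toLinearMap := spin S
  cont := by
    refine (PiLp.continuous_toLp 2 _).comp (continuous_pi fun a => ?_)
    exact continuous_finsetSum _ fun b _ =>
      ((continuous_apply b).comp (PiLp.continuous_ofLp 2 _)).const_smul (S a b)

/-- `S ⊗ 1` as an isometry, for a Hermitian matrix `S` with `S² = 1`. -/
def spinIsometry {S : Matrix (Fin 4) (Fin 4) ℂ} (hS : S.IsHermitian) (hS2 : S * S = 1) :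
    SpinorFock →ₗᵢ[ℂ] SpinorFock :=
  (spin S).isometryOfInner fun Ψ Φ => by rw [inner_spin hS, spin_spin, hS2, spin_one]

/-- `1 ⊗ U` for an isometry `U` of the Fock space. -/
def amplifyIsometry (U : Fock →ₗᵢ[ℂ] Fock) : SpinorFock →ₗᵢ[ℂ] SpinorFock where
  toFun Ψ := WithLp.toLp 2 fun a => U (Ψ a)
  map_add' Ψ Φ := by ext1 a; simp
  map_smul' c Ψ := by ext1 a; simp
  norm_map' Ψ := by
    change ‖WithLp.toLp 2 fun a => U (Ψ a)‖ = ‖Ψ‖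
    rw [PiLp.norm_eq_of_L2, PiLp.norm_eq_of_L2]
    simp

theorem spin_amplifyIsometry (U : Fock →ₗᵢ[ℂ] Fock) (S : Matrix (Fin 4) (Fin 4) ℂ)
    (Ψ : SpinorFock) : spin S (amplifyIsometry U Ψ) = amplifyIsometry U (spin S Ψ) := by
  ext1 a
  change ∑ b, S a b • U (Ψ b) = U (∑ b, S a b • Ψ b)
  simp

/-- `1 ⊗ B` commutes with `S ⊗ 1`. -/
theorem spin_mem_amplify_domain {B : Fock →ₗ.[ℂ] Fock} (S : Matrix (Fin 4) (Fin 4) ℂ)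
    (Ψ : (amplify B).domain) : ∃ h : spin S Ψ ∈ (amplify B).domain,
      amplify B ⟨spin S Ψ, h⟩ = spin S (amplify B Ψ) := by
  have h : spin S Ψ ∈ (amplify B).domain := fun a => by
    rw [spin_apply]
    exact B.domain.sum_mem fun b _ => B.domain.smul_mem _ (Ψ.2 b)
  refine ⟨h, ?_⟩
  ext1 a
  change B ⟨spin S Ψ a, h a⟩ = ∑ b, S a b • B ⟨Ψ.1 b, Ψ.2 b⟩
  have : (⟨spin S Ψ a, h a⟩ : B.domain) = ∑ b, S a b • (⟨Ψ.1 b, Ψ.2 b⟩ : B.domain) := by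
    apply Subtype.ext
    simp [spin_apply]
  rw [this]
  simp only [← LinearPMap.toFun_eq_coe, map_sum, map_smul]

theorem amplify_isFormalAdjoint {B : Fock →ₗ.[ℂ] Fock} (hB : B.IsFormalAdjoint B) :
    (amplify B).IsFormalAdjoint (amplify B) := fun Ψ Φ => by
  rw [PiLp.inner_apply, PiLp.inner_apply]
  exact Finset.sum_congr rfl fun a _ => hB ⟨Ψ.1 a, Ψ.2 a⟩ ⟨Φ.1 a, Φ.2 a⟩

theorem spin_compPMap_isFormalAdjoint {B : Fock →ₗ.[ℂ] Fock} (hB : B.IsFormalAdjoint B)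
    {S : Matrix (Fin 4) (Fin 4) ℂ} (hS : S.IsHermitian) :
    ((spin S).compPMap (amplify B)).IsFormalAdjoint ((spin S).compPMap (amplify B)) := by
  intro Ψ Φ
  rw [LinearMap.compPMap_apply, LinearMap.compPMap_apply, inner_spin hS]
  obtain ⟨h, hΦ⟩ := spin_mem_amplify_domain S Φ
  rw [← hΦ]
  exact amplify_isFormalAdjoint hB Ψ ⟨spin S Φ, h⟩

variable {β S : Matrix (Fin 4) (Fin 4) ℂ} {U : Fock →ₗᵢ[ℂ] Fock} {ε : ℂ} {B : Fock →ₗ.[ℂ] Fock}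

/-- The operator `β ⊗ U`. -/
def spinorParity (hβ : β.IsHermitian) (hβ2 : β * β = 1) (U : Fock →ₗᵢ[ℂ] Fock) :
    SpinorFock →ₗᵢ[ℂ] SpinorFock :=
  (amplifyIsometry U).comp (spinIsometry hβ hβ2)

theorem spinorParity_apply (hβ : β.IsHermitian) (hβ2 : β * β = 1) (Ψ : SpinorFock) :
    spinorParity hβ hβ2 U Ψ = amplifyIsometry U (spin β Ψ) := rfl

theorem spin_spinorParity (hβ : β.IsHermitian) (hβ2 : β * β = 1) (hS : S * β + β * S = 0)
    (Ψ : SpinorFock) :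
    spin S (spinorParity hβ hβ2 U Ψ) = -spinorParity hβ hβ2 U (spin S Ψ) := by
  rw [spinorParity_apply, spinorParity_apply, spin_amplifyIsometry, spin_spin, spin_spin,
    eq_neg_of_add_eq_zero_left hS, spin_neg, map_neg]

theorem Intertwines.amplify (hB : Intertwines U ε B) (hβ : β.IsHermitian) (hβ2 : β * β = 1) :
    Intertwines (spinorParity hβ hβ2 U) ε (amplify B) := by
  intro Ψ
  obtain ⟨h, hΨ⟩ := spin_mem_amplify_domain β Ψ
  refine ⟨fun a => (hB ⟨spin β Ψ a, h a⟩).1, ?_⟩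
  refine Eq.trans ?_ (congrArg (fun Φ => ε • amplifyIsometry U Φ) hΨ)
  ext1 a
  exact (hB ⟨spin β Ψ a, h a⟩).2

theorem Intertwines.spin_compPMap (hB : Intertwines U (-1) B) (hβ : β.IsHermitian)
    (hβ2 : β * β = 1) (hS : S * β + β * S = 0) :
    Intertwines (spinorParity hβ hβ2 U) 1 ((spin S).compPMap (DiracPolaron.amplify B)) := by
  intro Ψ
  obtain ⟨h, hΨ⟩ := hB.amplify hβ hβ2 Ψ
  refine ⟨h, ?_⟩
  rw [LinearMap.compPMap_apply, LinearMap.compPMap_apply]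
  refine (congrArg (spin S) hΨ).trans ?_
  rw [map_smul, spin_spinorParity hβ hβ2 hS, neg_smul, one_smul, one_smul, neg_neg]

end Spinor

/-! ### Symmetry and parity of the Hamiltonian -/

section Hamiltonian

variable {α : Fin 3 → Matrix (Fin 4) (Fin 4) ℂ} {β : Matrix (Fin 4) (Fin 4) ℂ}
  {e : Fin 2 → Momentum → Momentum} {ρ : Momentum → ℂ} {M q m : ℝ}

/-- Splitting off an everywhere defined term `f` from an operator sum keeps its domain. -/
theorem toPMap_add_eq_vadd {E : Type*} [AddCommGroup E] [Module ℂ E] {f g h : E →ₗ[ℂ] E}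
    (hfg : h = f + g) (A B C : E →ₗ.[ℂ] E) :
    h.toPMap ⊤ + A - B - C = f +ᵥ (g.toPMap ⊤ + A - B - C) := by
  subst hfg
  refine LinearPMap.ext rfl fun x h1 h2 => ?_
  rw [LinearPMap.vadd_apply, LinearPMap.sub_apply, LinearPMap.sub_apply, LinearPMap.add_apply,
    LinearPMap.sub_apply, LinearPMap.sub_apply, LinearPMap.add_apply, ← add_sub_assoc,
    ← add_sub_assoc, ← add_assoc]
  rfl

theorem isFormalAdjoint_sum {E : Type*} [NormedAddCommGroup E] [InnerProductSpace ℂ E]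
    {f : E →ₗ[ℂ] E} (hf : f.IsSymmetric) {A : E →ₗ.[ℂ] E} (hA : A.IsFormalAdjoint A)
    {B C : Fin 3 → E →ₗ.[ℂ] E} (hB : ∀ j, (B j).IsFormalAdjoint (B j))
    (hC : ∀ j, (C j).IsFormalAdjoint (C j)) (q : ℝ) :
    (f.toPMap ⊤ + A - ∑ j, B j - (q : ℂ) • ∑ j, C j).IsFormalAdjoint
      (f.toPMap ⊤ + A - ∑ j, B j - (q : ℂ) • ∑ j, C j) := by
  rw [Fin.sum_univ_three, Fin.sum_univ_three]
  exact IsFormalAdjoint.sub (IsFormalAdjoint.sub (IsFormalAdjoint.add (fun x y => hf x y) hA)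
    (IsFormalAdjoint.add (IsFormalAdjoint.add (hB 0) (hB 1)) (hB 2)))
    (IsFormalAdjoint.real_smul
      (IsFormalAdjoint.add (IsFormalAdjoint.add (hC 0) (hC 1)) (hC 2)) q)

theorem intertwines_sum {E : Type*} [NormedAddCommGroup E] [InnerProductSpace ℂ E]
    {U : E →ₗᵢ[ℂ] E} {f : E →ₗ[ℂ] E} (hf : ∀ x, f (U x) = U (f x)) {A : E →ₗ.[ℂ] E}
    (hA : Intertwines U 1 A) {B C : Fin 3 → E →ₗ.[ℂ] E} (hB : ∀ j, Intertwines U 1 (B j))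
    (hC : ∀ j, Intertwines U 1 (C j)) (q : ℂ) :
    Intertwines U 1 (f.toPMap ⊤ + A - ∑ j, B j - q • ∑ j, C j) := by
  have hf' : Intertwines U 1 (f.toPMap ⊤) := fun x => ⟨trivial, by
    rw [one_smul]
    exact hf x⟩
  rw [Fin.sum_univ_three, Fin.sum_univ_three]
  exact ((hf'.add hA).sub (((hB 0).add (hB 1)).add (hB 2))).sub
    ((((hC 0).add (hC 1)).add (hC 2)).smul q)

/-- At `p = 0` only the mass term is left of the free Dirac part. -/
theorem spin_mass (S : Matrix (Fin 4) (Fin 4) ℂ) :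
    spin ((∑ j, ((0 : Momentum) j : ℂ) • α j) + S) = spin S := by
  simp

/-- `H_m(p) = α·p + H_m(0)`, on the same domain. -/
theorem hamiltonian_eq_vadd (p : Momentum) : hamiltonian α β e ρ M q m p
    = (spinL (∑ j, (p j : ℂ) • α j) : SpinorFock →ₗ[ℂ] SpinorFock) +ᵥ
      hamiltonian α β e ρ M q m 0 := by
  have h : spin ((∑ j, (p j : ℂ) • α j) + (M : ℂ) • β)
      = spin (∑ j, (p j : ℂ) • α j) + spin ((M : ℂ) • β) := LinearMap.ext fun Ψ => spin_add _ _ Ψ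
  unfold hamiltonian
  rw [spin_mass]
  exact toPMap_add_eq_vadd h _ _ _

theorem isHermitian_sum_smul (hD : IsDirac α β) (p : Momentum) :
    (∑ j, (p j : ℂ) • α j).IsHermitian := by
  unfold Matrix.IsHermitian
  rw [Matrix.conjTranspose_sum]
  refine Finset.sum_congr rfl fun j _ => ?_
  rw [Matrix.conjTranspose_smul, hD.hermitian_alpha j]
  simp

theorem sum_smul_anticomm (hD : IsDirac α β) (p : Momentum) :
    (∑ j, (p j : ℂ) • α j) * β + β * (∑ j, (p j : ℂ) • α j) = 0 := by
  rw [Finset.sum_mul, Finset.mul_sum, ← Finset.sum_add_distrib]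
  refine Finset.sum_eq_zero fun j _ => ?_
  rw [Matrix.smul_mul, Matrix.mul_smul, ← smul_add, hD.anticomm_beta, smul_zero]

theorem hamiltonian_isFormalAdjoint (hD : IsDirac α β)
    (hg : ∀ j, MemLp (formFactor ρ e j) 2 modeMeasure) (p : Momentum) :
    (hamiltonian α β e ρ M q m p).IsFormalAdjoint (hamiltonian α β e ρ M q m p) := by
  have hM : ((M : ℂ) • β).IsHermitian := by
    unfold Matrix.IsHermitian
    rw [Matrix.conjTranspose_smul, hD.hermitian_beta]
    simp
  unfold hamiltonian
  exact isFormalAdjoint_sum (fun x y => inner_spin ((isHermitian_sum_smul hD p).add hM) x y)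
    (amplify_isFormalAdjoint (dGamma_isFormalAdjoint _))
    (fun j => spin_compPMap_isFormalAdjoint (dGamma_isFormalAdjoint _) (hD.hermitian_alpha j))
    (fun j => spin_compPMap_isFormalAdjoint (vectorPotential_isFormalAdjoint (hg j))
      (hD.hermitian_alpha j)) q

/-- `H_m(0)` commutes with the parity `β ⊗ Γ(u)`: both `α_j` and, under `Γ(u)`,
the operators `dΓ(k_j)` and `A_j` change their sign. -/
theorem intertwines_hamiltonian_zero (hD : IsDirac α β)
    (hg : ∀ j, MemLp (formFactor ρ e j) 2 modeMeasure) {v : Fin 2 → Mode → ℂ} (hv : IsParity v)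
    (hvg : ∀ j, weightedComp v modeFlip (formFactor ρ e j) =ᵐ[modeMeasure]
      fun y => -formFactor ρ e j y) :
    Intertwines (spinorParity hD.hermitian_beta hD.sq_beta hv.onFock) 1
      (hamiltonian α β e ρ M q m 0) := by
  have hω : Intertwines hv.onFock 1 (dGamma fun x => (1 + m) * ‖x.1‖ + m) := by
    have := hv.intertwines_dGamma (φ := fun x => (1 + m) * ‖x.1‖ + m) (ε := 1) (by norm_num)
      (fun s x => by simp [modeFlip])
    rwa [Complex.ofReal_one] at this
  have hk : ∀ j, Intertwines hv.onFock (-1) (dGamma fun x => x.1 j) := fun j => by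
    have := hv.intertwines_dGamma (φ := fun x => x.1 j) (ε := -1) (by norm_num)
      (fun s x => by simp [modeFlip])
    rwa [Complex.ofReal_neg, Complex.ofReal_one] at this
  have hβ : ∀ Ψ, spin ((M : ℂ) • β) (spinorParity hD.hermitian_beta hD.sq_beta hv.onFock Ψ)
      = spinorParity hD.hermitian_beta hD.sq_beta hv.onFock (spin ((M : ℂ) • β) Ψ) := fun Ψ => by
    rw [spinorParity_apply, spinorParity_apply, spin_amplifyIsometry, spin_spin, spin_spin,
      Matrix.smul_mul, Matrix.mul_smul]
  unfold hamiltonian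
  rw [spin_mass]
  exact intertwines_sum hβ (hω.amplify hD.hermitian_beta hD.sq_beta)
    (fun j => (hk j).spin_compPMap hD.hermitian_beta hD.sq_beta (hD.anticomm_beta j))
    (fun j => (hv.intertwines_vectorPotential (hg j) (hvg j)).spin_compPMap hD.hermitian_beta
      hD.sq_beta (hD.anticomm_beta j)) _

end Hamiltonian

end DiracPolaron

end

theorem theoremT1p7
    (α : Fin 3 → Matrix (Fin 4) (Fin 4) ℂ) (β : Matrix (Fin 4) (Fin 4) ℂ)
    (hD : DiracPolaron.IsDirac α β)
    (e : Fin 2 → DiracPolaron.Momentum → DiracPolaron.Momentum)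
    (he : DiracPolaron.IsPolarization e)
    (ρ : DiracPolaron.Momentum → ℂ)
    (hρ : MeasureTheory.MemLp ρ 2 MeasureTheory.volume)
    (hρω : MeasureTheory.MemLp (fun k => ((‖k‖⁻¹ : ℝ) : ℂ) * ρ k) 2 MeasureTheory.volume)
    (hsymm : ∀ᵐ k ∂(MeasureTheory.volume : MeasureTheory.Measure DiracPolaron.Momentum),
      ‖ρ k‖ = ‖ρ (-k)‖)
    (M q m : ℝ) (hm : 0 ≤ m) (p : DiracPolaron.Momentum) :
    DiracPolaron.lowestEnergy α β e ρ M q m p ≤ DiracPolaron.lowestEnergy α β e ρ M q m 0 := by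
  have hg := DiracPolaron.memLp_formFactor he hρ hρω
  -- the parity is built from a measurable representative `r` of `ρ`
  obtain ⟨r, hr, hρr⟩ := hρ.1
  have hv := DiracPolaron.isParity_parityCoeff hr.measurable he
  have hU := DiracPolaron.intertwines_hamiltonian_zero (M := M) (q := q) (m := m) hD hg hv
    fun j => DiracPolaron.weightedComp_parityCoeff_formFactor he hρr hsymm j
  have hH := DiracPolaron.hamiltonian_isFormalAdjoint (M := M) (q := q) (m := m) hD hg p
  refine le_iInf₂ fun z hz => ?_
  by_contra hlt
  push Not at hlt
  -- a real number `c` between a spectral point of `H_m(0)` and `E_m(p)`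
  obtain ⟨c, hzc, hcE⟩ := EReal.lt_iff_exists_real_btwn.1 hlt
  have hc : ∀ w ∈ DiracPolaron.opSpectrum (DiracPolaron.hamiltonian α β e ρ M q m p).closure,
      c ≤ w.re := fun w hw => EReal.coe_le_coe_iff.1 (hcE.le.trans (iInf₂_le w hw))
  rw [DiracPolaron.hamiltonian_eq_vadd] at hH hc
  refine (EReal.coe_lt_coe_iff.1 hzc).not_ge (DiracPolaron.spectrum_ge_of_vadd
    (U := DiracPolaron.spinorParity hD.hermitian_beta hD.sq_beta hv.onFock) hH (fun x => ?_) hc z hz)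
  obtain ⟨h, hx⟩ := hU x
  refine ⟨h, ?_⟩
  rw [hx, one_smul, map_sub, sub_eq_add_neg]
  exact congrArg _ (DiracPolaron.spin_spinorParity _ _ (DiracPolaron.sum_smul_anticomm hD p) _)
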